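/- Fix integers $n\ge 2$, $d\ge 2$, $m\ge 1$. Let $q_1,\dots,q_{2^d}$ be the points of $\{0,1\}^d$, $q_0=(\tfrac12,\dots,\tfrac12)$, and for $1\le i\le 2^d$, $1\le j\le n$ let $$F_{i,j}(x)=\tfrac{1}{2n-1}x+\tfrac{2n-2}{2n-1}\Big(\tfrac{n-j}{n-1}q_i+\tfrac{j-1}{n-1}q_0\Big).$$ Let $V_0=\{q_1,\dots,q_{2^d}\}$, let $E_0$ be the set of all pairs of distinct points of $V_0$, and put $V_{k+1}=\bigcup_{i,j}F_{i,j}V_k$, $E_{k+1}=\{\{F_{i,j}x,F_{i,j}y\}:\{x,y\}\in E_k,\ 1\le i\le 2^d,\ 1\le j\le n\}$. On the graph $(V_m,E_m)$ let $\Delta_m f(x)=N_x^{-1}\sum_{y:\{x,y\}\in E_m}f(y)-f(x)$, where $N_x$ is the degree of $x$. A real number $\lambda$ is a Dirichlet eigenvalue of $-\Delta_m$ if there is $f\ne0$ on $V_m$ with $f|_{V_0}=0$ and $-\Delta_mf=\lambda f$ on $V_m\setminus V_0$; its multiplicity $M_{m,D}(\lambda)$ is the dimension of the space of all such $f$ (together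 with $0$). Let $\sigma_{m,D}$ be the set of Dirichlet eigenvalues. Let $T_k,U_k$ be the Chebyshev polynomials of the first and second kind, $t=1-(2^d-1)\lambda$, and $$R_{n,d}(\lambda)=1+(\lambda-1)U_{n-1}(t)^2+(t+\lambda+1)U_{n-1}(t)U_{n-2}(t)-t\,U_{n-2}(t)^2,$$ $$S_{n,d}(\lambda)=T_n(t)+(2^d-1)T_{n-1}(t),\qquad A_{n,d}(\lambda)=U_{n-1}(t)+U_{n-2}(t).$$ **Theorem.** (i) For every $x\in I:=[0,\frac{2^d}{2^d-1}]$ the equation $R_{n,d}(\lambda)=x$ has exactly $2n-1$ distinct real solutions, all of them in $I$; write them as $\psi_0(x)<\psi_1(x)<\dots<\psi_{2n-2}(x)$. The polynomial $S_{n,d}$ has exactly $n$ distinct real roots $\alpha_1,\dots,\alpha_n$, and $A_{n,d}$ has exactly $n-1$ distinct real roots $\beta_1,\dots,\beta_{n-1}$; all of them lie in $I$. (ii) For a word $v=v_1\cdots v_k$ in the letters $0,1,\dots,2n-2$ put $|v|=k$ and $\psi_v=\psi_{v_k}\circ\cdots\circ\psi_{v_1}$ (the identity if $v=\emptyset$).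 Then $$\begin{aligned}\sigma_{m,D}=&\ \big\{\psi_v(\tfrac{2^d}{2^d-1}): |v|\le m-1,\ v=\emptyset\text{ or }v_1\in\{0,2,4,\dots,2n-4\}\big\}\\ &\cup\{\psi_v(\alpha_i):1\le i\le n,\ |v|=m-1\}\ \cup\ \{\psi_v(\beta_i):1\le i\le n-1,\ |v|\le m-1\}.\end{aligned}$$ (iii) The multiplicities are $$\begin{cases}M_{m,D}\big(\psi_v(\tfrac{2^d}{2^d-1})\big)=(2^dn-2^d+1)^{m-|v|}(2^d-2)+1-2^d,& |v|\le m-1,\ v=\emptyset\text{ or }v_1\in\{0,2,\dots,2n-4\},\\ M_{m,D}(\psi_v(\alpha_i))=1,&1\le i\le n,\ |v|=m-1,\\ M_{m,D}(\psi_v(\beta_i))=2^d-1,&1\le i\le n-1,\ |v|\le m-1.\end{cases}$$ -/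

import Mathlib

open Polynomial

namespace Vicsek

noncomputable section

/-- The corner of the cube `[0,1]^d` with 0-1 coordinates `a`; these are the points `q_i`. -/
def corner {d : ℕ} (a : Fin d → Bool) : Fin d → ℝ := fun k => if a k then 1 else 0

/-- The centre `q_0` of the cube. -/
def center (d : ℕ) : Fin d → ℝ := fun _ => 1 / 2

/-- The contraction `F_{i,j}` of the iterated function system (used for `1 ≤ j ≤ n`), where the
corner `q_i` is given by its coordinates `a`. -/
def contraction (n : ℕ) {d : ℕ} (a : Fin d → Bool) (j : ℕ) (x : Fin d → ℝ) : Fin d → ℝ :=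
  (1 / (2 * (n : ℝ) - 1)) • x +
    ((2 * (n : ℝ) - 2) / (2 * (n : ℝ) - 1)) •
      ((((n : ℝ) - j) / ((n : ℝ) - 1)) • corner a + (((j : ℝ) - 1) / ((n : ℝ) - 1)) • center d)

open Classical in
/-- The vertex set `V_m` of the level-`m` graph: `V_0` is the set of corners of the cube, and
`V_{m+1}` is the union of the sets `F_{i,j} V_m`. -/
def vertices (n d : ℕ) : ℕ → Finset (Fin d → ℝ)
  | 0 => Finset.univ.image corner
  | m + 1 => (Finset.univ : Finset (Fin d → Bool)).biUnion fun a =>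
      (Finset.Icc 1 n).biUnion fun j => (vertices n d m).image (contraction n a j)

/-- The edge set `E_m` of the level-`m` graph: `E_0` consists of all pairs of distinct corners, and
`E_{m+1}` of the images of the edges in `E_m` under the maps `F_{i,j}`. -/
def edges (n d : ℕ) : ℕ → Set (Sym2 (Fin d → ℝ))
  | 0 => {e | ∃ a b : Fin d → Bool, a ≠ b ∧ e = s(corner a, corner b)}
  | m + 1 => {e | ∃ a : Fin d → Bool, ∃ j ∈ Finset.Icc 1 n, ∃ e' ∈ edges n d m,
      e = e'.map (contraction n a j)}

/-- The level-`m` approximating graph `G_m = (V_m, E_m)`. -/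
def graph (n d m : ℕ) : SimpleGraph (vertices n d m) :=
  (SimpleGraph.fromEdgeSet (edges n d m)).comap fun x : vertices n d m => (x : Fin d → ℝ)

open Classical in
/-- The graph Laplacian
`Δ_m f(x) = N_x⁻¹ ∑_{y ∼ x} f(y) - f(x)`, with `N_x` the degree of `x`. -/
def laplacian (n d m : ℕ) (f : vertices n d m → ℝ) (x : vertices n d m) : ℝ :=
  ((graph n d m).degree x : ℝ)⁻¹ * (∑ y ∈ (graph n d m).neighborFinset x, f y) - f x

/-- The space of functions `f` on `V_m` vanishing on the boundary `V_0` with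
`-Δ_m f = lam • f` on `V_m \ V_0`. -/
def dirichletEigenspace (n d m : ℕ) (lam : ℝ) : Submodule ℝ (vertices n d m → ℝ) where
  carrier := {f | (∀ x : vertices n d m, (x : Fin d → ℝ) ∈ vertices n d 0 → f x = 0) ∧
    ∀ x : vertices n d m, (x : Fin d → ℝ) ∉ vertices n d 0 → -laplacian n d m f x = lam * f x}
  zero_mem' := by
    refine ⟨fun x _ => rfl, fun x _ => ?_⟩
    simp [laplacian]
  add_mem' := by
    rintro f g ⟨hf, hf'⟩ ⟨hg, hg'⟩
    refine ⟨fun x hx => by simp [hf x hx, hg x hx], fun x hx => ?_⟩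
    have h1 := hf' x hx
    have h2 := hg' x hx
    simp only [laplacian, Pi.add_apply, Finset.sum_add_distrib] at *
    linear_combination h1 + h2
  smul_mem' := by
    rintro c f ⟨hf, hf'⟩
    refine ⟨fun x hx => by simp [hf x hx], fun x hx => ?_⟩
    have h1 := hf' x hx
    simp only [laplacian, Pi.smul_apply, smul_eq_mul, ← Finset.mul_sum] at *
    linear_combination c * h1

/-- The Dirichlet spectrum `σ_{m,D}` of `-Δ_m`: those `lam` having a nonzero Dirichlet
eigenfunction. -/
def dirichletSpectrum (n d m : ℕ) : Set ℝ := {lam | dirichletEigenspace n d m lam ≠ ⊥}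

/-- The multiplicity `M_{m,D}(lam)` of a Dirichlet eigenvalue. -/
def dirichletMultiplicity (n d m : ℕ) (lam : ℝ) : ℕ :=
  Module.finrank ℝ (dirichletEigenspace n d m lam)

/-- `t = 1 - (2^d - 1) λ`, as a polynomial in `λ`. -/
def tPoly (d : ℕ) : ℝ[X] := 1 - C ((2 : ℝ) ^ d - 1) * X

/-- The Chebyshev polynomial of the first kind evaluated at `t`, as a polynomial in `λ`. -/
def chebT (d : ℕ) (k : ℤ) : ℝ[X] := (Chebyshev.T ℝ k).comp (tPoly d)

/-- The Chebyshev polynomial of the second kind evaluated at `t`, as a polynomial in `λ`. -/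
def chebU (d : ℕ) (k : ℤ) : ℝ[X] := (Chebyshev.U ℝ k).comp (tPoly d)

/-- The spectral decimation polynomial `R_{n,d}(λ)`. -/
def R (n d : ℕ) : ℝ[X] :=
  1 + (X - 1) * chebU d (n - 1) ^ 2 + (tPoly d + X + 1) * chebU d (n - 1) * chebU d (n - 2)
    - tPoly d * chebU d (n - 2) ^ 2

/-- `S_{n,d}(λ) = T_n(t) + (2^d - 1) T_{n-1}(t)`. -/
def S (n d : ℕ) : ℝ[X] := chebT d n + C ((2 : ℝ) ^ d - 1) * chebT d (n - 1)

/-- `A_{n,d}(λ) = U_{n-1}(t) + U_{n-2}(t)`. -/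
def A (n d : ℕ) : ℝ[X] := chebU d (n - 1) + chebU d (n - 2)

/-- The number `2^d / (2^d - 1)`. -/
def top (d : ℕ) : ℝ := (2 : ℝ) ^ d / ((2 : ℝ) ^ d - 1)

open Classical in
/-- The inverse branches `ψ_0, …, ψ_{2n-2}` of `R_{n,d}` in increasing order: `ψ_l(x)` is the
entry with index `l` (counted from `0`) of the increasing list of the distinct real solutions `y`
of `R_{n,d}(y) = x`. (The value is `0` if there are at most `l` solutions.) -/
def branch (n d l : ℕ) (x : ℝ) : ℝ :=
  ((R n d - C x).roots.toFinset.sort (· ≤ ·)).getD l 0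

/-- `ψ_v = ψ_{v_k} ∘ ⋯ ∘ ψ_{v_1}` for a word `v = v_1 ⋯ v_k` in the letters `0, …, 2n-2`; the
identity for the empty word. -/
def branchWord (n d : ℕ) (v : List (Fin (2 * n - 1))) (x : ℝ) : ℝ :=
  v.foldl (fun (y : ℝ) (l : Fin (2 * n - 1)) => branch n d l.val y) x

/-- The word is empty or its first letter is one of `0, 2, 4, …, 2n-4`. -/
def Admissible {n : ℕ} (v : List (Fin (2 * n - 1))) : Prop :=
  ∀ l ∈ v.head?, Even (l : ℕ) ∧ (l : ℕ) + 4 ≤ 2 * n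

end

end Vicsek

/-! Write `P = 2^d`, `n = L + 2` and `s = P - (P-1)λ = t + P - 1`. The graphs are glued from
complete graphs on `P` vertices (cells), and the eigenvalue equation at `v` says that the sum, over
the cells containing `v`, of (cell sum of `f`) `- s f(v)` vanishes; `CellSystem.form` is its weak
version. The next level replaces each cell by a central cell and `P` arms of `L + 1` cells. Let
`y_j` be the values of a function along the diagonal of an arm and `z_j` the common value at the
off-diagonal corners of its `j`-th cell. The equation becomes a linear recursion solved by Chebyshev
polynomials, and all that an arm leaves on the old vertices is the flux `s (z_0 - y_0)`
(`form_extend`). Fitting the arms to the central cell determines `z_0` from the old values unless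
`A` or `S` vanishes, and the flux is then proportional to (cell sum) `- s' f` with `s' = P - (P-1)
R(λ)`. So eigenfunctions for `R(λ)` extend to eigenfunctions for `λ` one level up
(`finrank_eigen_le_refine`). Further eigenfunctions come from zero cell sums (`s = 0`), from zeros
of `A`, and, at level one, from zeros of `S`.

These constructions give only lower bounds, collected in `expectedMult`. A dimension count makes
them sharp: eigenspaces for distinct eigenvalues are independent, so all multiplicities together are
at most `|V_m| - P` (`sum_multiplicity_le`), while the lower bounds over a suitable finite set add
up to exactly this number (`exists_sum_expectedMult`). Hence each is an equality and no other
eigenvalue exists (`dirichletMultiplicity_eq`); uniqueness of extensions is never needed.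

The count requires full fibres of `R` and simple real roots of `A`, `S` and `U_{n-1} - U_{n-2}`.
With `t = cos 2h` these follow from explicit roots or sign changes together with degree bounds.
Since `P - (P-1)R = S (U_{n-1} - U_{n-2})`, the fibre over `top` consists of the zeros of `S`, where
decimation fails, and those of the other factor, which are the branches with admissible first
letter.

That the abstract cell systems are the given graphs is checked in integer coordinates: the
coordinates of a cell all have the same parity, so distinct cells meet in at most one common corner.
-/

namespace Vicsek

noncomputable section

set_option linter.unusedSectionVars false

/-! ### Cell systems and the weak eigenvalue equation -/

/-- A finite family of cells, each with corners indexed by `Q`, glued along common vertices,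
together with distinguished boundary vertices. -/
structure CellSystem (Q : Type) where
  V : Type
  C : Type
  [fintypeV : Fintype V]
  [fintypeC : Fintype C]
  corner : C → Q → V
  bdry : Q → V

attribute [instance] CellSystem.fintypeV CellSystem.fintypeC

namespace CellSystem

open Module

variable {Q : Type} [Fintype Q] [DecidableEq Q]

/-- The sum of a function over the corners of a cell. -/
def cellSum (X : CellSystem Q) (f : X.V → ℝ) (w : X.C) : ℝ := ∑ a, f (X.corner w a)

theorem cellSum_def (X : CellSystem Q) (f : X.V → ℝ) (w : X.C) :
    X.cellSum f w = ∑ a, f (X.corner w a) := rfl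

/-- The weak form of the eigenvalue equation, tested against `g`. -/
def form (X : CellSystem Q) (s : ℝ) (f g : X.V → ℝ) : ℝ :=
  ∑ w, ∑ a, (X.cellSum f w - s * f (X.corner w a)) * g (X.corner w a)

theorem form_add (X : CellSystem Q) (s : ℝ) (f f' g : X.V → ℝ) :
    X.form s (f + f') g = X.form s f g + X.form s f' g := by
  simp only [form, cellSum, Pi.add_apply, ← Finset.sum_add_distrib]
  refine Finset.sum_congr rfl fun w _ => Finset.sum_congr rfl fun a _ => ?_
  rw [Finset.sum_add_distrib]; ring

theorem form_smul (X : CellSystem Q) (s c : ℝ) (f g : X.V → ℝ) :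
    X.form s (c • f) g = c * X.form s f g := by
  simp only [form, cellSum, Pi.smul_apply, smul_eq_mul, Finset.mul_sum]
  refine Finset.sum_congr rfl fun w _ => Finset.sum_congr rfl fun a _ => ?_
  rw [← Finset.mul_sum]; ring

/-- Functions vanishing on the boundary that solve the weak eigenvalue equation. -/
def eigen (X : CellSystem Q) (s : ℝ) : Submodule ℝ (X.V → ℝ) where
  carrier := {f | (∀ a, f (X.bdry a) = 0) ∧ ∀ g, (∀ a, g (X.bdry a) = 0) → X.form s f g = 0}
  zero_mem' := ⟨fun _ => rfl, fun g _ => by simp [form, cellSum]⟩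
  add_mem' := by
    rintro f f' ⟨hf, hf'⟩ ⟨hg, hg'⟩
    refine ⟨fun a => by simp [hf a, hg a], fun g h => ?_⟩
    rw [form_add, hf' g h, hg' g h, add_zero]
  smul_mem' := by
    rintro c f ⟨hf, hf'⟩
    refine ⟨fun a => by simp [hf a], fun g h => ?_⟩
    rw [form_smul, hf' g h, mul_zero]

/-! ### Subdivision of cells and Chebyshev recursion along the arms -/

variable (L : ℕ) (τ : Q → Q) (hτ : ∀ i, τ i ≠ i)

/-- The vertices created inside a cell when it is subdivided: `(i, j, a)` stands for the corner
`a` of the `j`-th cell on the arm that starts at the corner `i`. -/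
abbrev NewVertex (Q : Type) (L : ℕ) : Type := {p : Q × Fin (L + 1) × Q // p.2.2 ≠ p.1}

variable {L τ} in
/-- The vertices along the diagonal of the `i`-th arm of the subdivision of the cell `w`. -/
def spine (X : CellSystem Q) (w : X.C) (i : Q) : Fin (L + 2) → X.V ⊕ (X.C × NewVertex Q L) :=
  Fin.cons (Sum.inl (X.corner w i)) fun j => Sum.inr (w, ⟨(i, j, τ i), hτ i⟩)

/-- Replace each cell by a central cell and arms of `L + 1` cells joining its corners to
those of the old cell. -/
abbrev refine (X : CellSystem Q) : CellSystem Q where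
  V := X.V ⊕ (X.C × NewVertex Q L)
  C := X.C × Option (Q × Fin (L + 1))
  corner
    -- The central cell owns no vertices: its corners are the inner ends of the arms. Likewise the
    -- corner `i` of an arm cell is the preceding spine vertex.
    | (w, none), a => X.spine hτ w a (Fin.last _)
    | (w, some (i, j)), a =>
      if h : a = i then X.spine hτ w i j.castSucc else Sum.inr (w, ⟨(i, j, a), h⟩)
  bdry a := Sum.inl (X.bdry a)

/-- `U_j(t)`. -/
def cU (t : ℝ) (j : ℤ) : ℝ := (Chebyshev.U ℝ j).eval t

theorem cU_add_two (t : ℝ) (j : ℤ) : cU t (j + 2) = 2 * t * cU t (j + 1) - cU t j := by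
  simp [cU, Chebyshev.U_add_two]

@[simp] theorem cU_zero (t : ℝ) : cU t 0 = 1 := by simp [cU]
@[simp] theorem cU_neg_one (t : ℝ) : cU t (-1) = 0 := by simp [cU]

/-- The quadratic form is invariant under the Chebyshev recursion and equals 1 at the start. -/
theorem cU_sq (t : ℝ) (j : ℕ) :
    cU t j ^ 2 - 2 * t * cU t j * cU t (j - 1) + cU t (j - 1) ^ 2 = 1 := by
  induction j with
  | zero => simp
  | succ j ih =>
    have h := cU_add_two t (j - 1)
    rw [show (j : ℤ) - 1 + 2 = j + 1 by ring, show (j : ℤ) - 1 + 1 = j by ring] at h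
    push_cast
    rw [add_sub_cancel_right, h]
    linear_combination ih

/-- Value at the `j`-th spine vertex of an arm with value `a` at its outer end and value `b` at
the free vertices of its outermost cell. -/
def armY (t a b : ℝ) (j : ℕ) : ℝ :=
  (t + 1) * cU t (j - 1) * b - (cU t (j - 1) + cU t (j - 2)) * a

/-- Value at the free vertices of the `j`-th cell of the arm. -/
def armZ (t a b : ℝ) (j : ℕ) : ℝ := (cU t j + cU t (j - 1)) * b - 2 * cU t (j - 1) * a

theorem armY_zero (t a b : ℝ) : armY t a b 0 = a := by
  have h := cU_add_two t (-2)
  norm_num at h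
  simp only [armY, Nat.cast_zero, zero_sub, cU_neg_one]
  linear_combination -a * h

theorem armZ_zero (t a b : ℝ) : armZ t a b 0 = b := by
  simp [armZ]

/-- This is the equation at an off-diagonal corner of the `j`-th cell: `y_j + y_{j+1} + (P-2) z_j =
s z_j` with `s = t + P - 1`. -/
theorem armY_succ (t a b : ℝ) (j : ℕ) :
    armY t a b (j + 1) = (t + 1) * armZ t a b j - armY t a b j := by
  have h := cU_add_two t (j - 2)
  rw [show (j : ℤ) - 2 + 2 = j by ring, show (j : ℤ) - 2 + 1 = j - 1 by ring] at h
  simp only [armY, armZ, Nat.cast_add, Nat.cast_one]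
  rw [show (j : ℤ) + 1 - 1 = j by ring, show (j : ℤ) + 1 - 2 = j - 1 by ring]
  linear_combination -a * h

/-- This is the equation at the vertex shared by two successive arm cells, whose contributions `s
(z_j - y_{j+1})` and `s (z_{j+1} - y_{j+1})` must cancel. -/
theorem armZ_succ (t a b : ℝ) (j : ℕ) :
    armZ t a b (j + 1) = 2 * armY t a b (j + 1) - armZ t a b j := by
  have h := cU_add_two t (j - 1)
  rw [show (j : ℤ) - 1 + 2 = j + 1 by ring, show (j : ℤ) - 1 + 1 = j by ring] at h
  simp only [armY, armZ, Nat.cast_add, Nat.cast_one]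
  rw [show (j : ℤ) + 1 - 1 = j by ring, show (j : ℤ) + 1 - 2 = j - 1 by ring]
  linear_combination b * h

/-- The extension of `f` to the refinement with value `b w i` at the free vertices of the
outermost cell of the `i`-th arm of `w`. -/
def extend (X : CellSystem Q) (t : ℝ) (f : X.V → ℝ) (b : X.C → Q → ℝ) :
    (X.refine L τ hτ).V → ℝ :=
  Sum.elim f fun p => if p.2.1.2.2 = τ p.2.1.1
    then armY t (f (X.corner p.1 p.2.1.1)) (b p.1 p.2.1.1) (p.2.1.2.1 + 1)
    else armZ t (f (X.corner p.1 p.2.1.1)) (b p.1 p.2.1.1) p.2.1.2.1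

theorem extend_spine (X : CellSystem Q) (t : ℝ) (f : X.V → ℝ) (b : X.C → Q → ℝ) (w : X.C) (i : Q)
    (j : Fin (L + 2)) :
    X.extend L τ hτ t f b (X.spine hτ w i j) = armY t (f (X.corner w i)) (b w i) j := by
  cases j using Fin.cases with
  | zero => simp [extend, spine, armY_zero]
  | succ j => simp [extend, spine]

theorem sum_two_special {i k : Q} (hik : k ≠ i) (F : Q → ℝ) (p q r : ℝ) (hi : F i = p) (hk : F k = q)
    (hr : ∀ a, a ≠ i → a ≠ k → F a = r) :
    ∑ a, F a = p + q + (Fintype.card Q - 2) * r := by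
  have h : ∀ a, F a = r + (if a = i then p - r else 0) + (if a = k then q - r else 0) := by
    intro a
    by_cases h1 : a = i
    · subst h1; simp [hi, hik.symm]
    · by_cases h2 : a = k
      · subst h2; simp [hk, h1]
      · simp [h1, h2, hr a h1 h2]
  simp_rw [h]
  simp [Finset.sum_add_distrib]
  ring

/-- The contribution of an arm telescopes to the difference of the fluxes at its two ends. By `hc`
the central cell contributes exactly the flux at the inner end, so only the flux at the old corner
survives. -/
theorem form_extend (X : CellSystem Q) (t s : ℝ) (hs : s = t + Fintype.card Q - 1) (f : X.V → ℝ)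
    (b : X.C → Q → ℝ)
    (hc : ∀ w i, s * armZ t (f (X.corner w i)) (b w i) (L + 1) =
      ∑ k, armY t (f (X.corner w k)) (b w k) (L + 1))
    (g : (X.refine L τ hτ).V → ℝ) :
    (X.refine L τ hτ).form s (X.extend L τ hτ t f b) g =
      ∑ w, ∑ i, s * (b w i - f (X.corner w i)) * g (Sum.inl (X.corner w i)) := by
  have hnone : ∀ w : X.C, ∀ a, (X.refine L τ hτ).corner (w, none) a =
    X.spine hτ w a (Fin.last _) := fun _ _ => rfl
  have hsome : ∀ (w : X.C) (i j a), (X.refine L τ hτ).corner (w, some (i, j)) a =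
    if h : a = i then X.spine hτ w i j.castSucc else Sum.inr (w, ⟨(i, j, a), h⟩) :=
    fun _ _ _ _ => rfl
  have hi : ∀ (w : X.C) (i j), (X.refine L τ hτ).corner (w, some (i, j)) i =
    X.spine hτ w i j.castSucc := fun w i j => by rw [hsome, dif_pos rfl]
  have hk : ∀ (w : X.C) (i j), (X.refine L τ hτ).corner (w, some (i, j)) (τ i) =
    X.spine hτ w i j.succ := fun w i j => by rw [hsome, dif_neg (hτ i)]; rfl
  have hfree : ∀ (w : X.C) (i j a), a ≠ i → a ≠ τ i → X.extend L τ hτ t f b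
      ((X.refine L τ hτ).corner (w, some (i, j)) a) =
        armZ t (f (X.corner w i)) (b w i) j := fun w i j a h1 h2 => by
    simp [h1, extend, h2]
  have hsum : ∀ (w : X.C) (i j), (X.refine L τ hτ).cellSum (X.extend L τ hτ t f b)
      (w, some (i, j)) = s * armZ t (f (X.corner w i)) (b w i) j := by
    intro w i j
    rw [cellSum_def, sum_two_special (hτ i) _ _ _ _ (by rw [hi, extend_spine])
      (by rw [hk, extend_spine]) (hfree w i j)]
    simp only [Fin.val_castSucc, Fin.val_succ]
    rw [armY_succ, hs]
    ring
  have hsum0 : ∀ (w : X.C) (i), (X.refine L τ hτ).cellSum (X.extend L τ hτ t f b)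
      (w, none) = s * armZ t (f (X.corner w i)) (b w i) (L + 1) := by
    intro w i
    rw [hc, cellSum_def]
    refine Finset.sum_congr rfl fun a _ => ?_
    rw [hnone, extend_spine, Fin.val_last]
  rw [form]
  change ∑ p : X.C × Option (Q × Fin (L + 1)), _ = _
  rw [Fintype.sum_prod_type]
  refine Finset.sum_congr rfl fun w _ => ?_
  rw [Fintype.sum_option, Fintype.sum_prod_type, ← Finset.sum_add_distrib]
  refine Finset.sum_congr rfl fun i _ => ?_
  -- `h` is the flux through a spine vertex. An arm cell adds it at its outer diagonal corner,
  -- subtracts it at its inner one (by `armZ_succ`), and gives 0 at its other corners.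
  set h : Fin (L + 2) → ℝ := fun j =>
    s * (armZ t (f (X.corner w i)) (b w i) j - armY t (f (X.corner w i)) (b w i) j) *
      g (X.spine hτ w i j) with hh
  have harm : ∀ j : Fin (L + 1), ∑ a, ((X.refine L τ hτ).cellSum (X.extend L τ hτ t f b)
      (w, some (i, j)) - s * X.extend L τ hτ t f b
      ((X.refine L τ hτ).corner (w, some (i, j)) a)) *
        g ((X.refine L τ hτ).corner (w, some (i, j)) a) = h j.castSucc - h j.succ := by
    intro j
    rw [sum_two_special (hτ i) _ (h j.castSucc) (-h j.succ) 0]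
    · ring
    · rw [hsum, hi, extend_spine, hh]
      simp only [Fin.val_castSucc]
      ring
    · rw [hsum, hk, extend_spine, hh]
      simp only [Fin.val_succ]
      rw [armZ_succ]
      ring
    · intro a h1 h2
      rw [hfree w i j a h1 h2, hsum]
      ring
  rw [Finset.sum_congr rfl fun j _ => harm j, Finset.sum_sub_distrib]
  have e1 := Fin.sum_univ_castSucc h
  have e2 := Fin.sum_univ_succ h
  have e3 : h 0 = s * (b w i - f (X.corner w i)) * g (Sum.inl (X.corner w i)) := by
    simp [hh, armZ_zero, armY_zero, spine]
  have e4 : h (Fin.last _) = ((X.refine L τ hτ).cellSum (X.extend L τ hτ t f b) (w, none) -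
      s * X.extend L τ hτ t f b ((X.refine L τ hτ).corner (w, none) i)) *
        g ((X.refine L τ hτ).corner (w, none) i) := by
    rw [hsum0 w i, hnone, extend_spine, hh]
    simp only [Fin.val_last]
    ring
  rw [← e4, ← e3]
  linarith

theorem extend_mem_eigen (X : CellSystem Q) (t s : ℝ) (hs : s = t + Fintype.card Q - 1)
    (f : X.V → ℝ) (b : X.C → Q → ℝ) (hf : ∀ a, f (X.bdry a) = 0)
    (hc : ∀ w i, s * armZ t (f (X.corner w i)) (b w i) (L + 1) =
      ∑ k, armY t (f (X.corner w k)) (b w k) (L + 1))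
    (hb : ∀ g : X.V → ℝ, (∀ a, g (X.bdry a) = 0) →
      ∑ w, ∑ i, (b w i - f (X.corner w i)) * g (X.corner w i) = 0) :
    X.extend L τ hτ t f b ∈ (X.refine L τ hτ).eigen s := by
  refine ⟨hf, fun g hg => ?_⟩
  rw [form_extend L τ hτ X t s hs f b hc]
  simp only [mul_assoc, ← Finset.mul_sum]
  rw [hb (fun v => g (Sum.inl v)) hg, mul_zero]

theorem armZ_last (t a b : ℝ) :
    armZ t a b (L + 1) = (cU t (L + 1) + cU t L) * b - 2 * cU t L * a := by
  simp only [armZ, Nat.cast_add, Nat.cast_one, add_sub_cancel_right]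

theorem armY_last (t a b : ℝ) :
    armY t a b (L + 1) = (t + 1) * cU t L * b - (cU t L + cU t (L - 1)) * a := by
  simp only [armY, Nat.cast_add, Nat.cast_one, add_sub_cancel_right]
  rw [show (L : ℤ) + 1 - 2 = L - 1 by ring]

theorem extend_add (X : CellSystem Q) (t : ℝ) (f f' : X.V → ℝ) (b b' : X.C → Q → ℝ) :
    X.extend L τ hτ t (f + f') (b + b') = X.extend L τ hτ t f b + X.extend L τ hτ t f' b' := by
  funext v
  rcases v with v | p
  · rfl
  · simp only [extend, Sum.elim_inr, Pi.add_apply, armY, armZ]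
    split_ifs <;> ring

theorem extend_smul (X : CellSystem Q) (t c : ℝ) (f : X.V → ℝ) (b : X.C → Q → ℝ) :
    X.extend L τ hτ t (c • f) (c • b) = c • X.extend L τ hτ t f b := by
  funext v
  rcases v with v | p
  · rfl
  · simp only [extend, Sum.elim_inr, Pi.smul_apply, smul_eq_mul, armY, armZ]
    split_ifs <;> ring

theorem exists_ne_ne (hQ : 3 ≤ Fintype.card Q) (i k : Q) : ∃ a, a ≠ i ∧ a ≠ k := by
  by_contra! h
  have : (Finset.univ : Finset Q) ⊆ {i, k} := by
    intro a _
    by_cases h1 : a = i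
    · simp [h1]
    · simp [h a h1]
  have := Finset.card_le_card this
  have h2 := Finset.card_le_two (a := i) (b := k)
  rw [Finset.card_univ] at this
  omega

/-- Recovers `b` from the extension, which is what makes `b ↦ extend` injective. Three corners are
needed for a cell to have one off the diagonal. -/
theorem extend_free (hQ : 3 ≤ Fintype.card Q) (X : CellSystem Q) (t : ℝ) (f : X.V → ℝ)
    (w : X.C) (i : Q) :
    ∃ v, ∀ b : X.C → Q → ℝ, X.extend L τ hτ t f b v = b w i := by
  obtain ⟨a, h1, h2⟩ := exists_ne_ne hQ i (τ i)
  refine ⟨Sum.inr (w, ⟨(i, 0, a), h1⟩), fun b => ?_⟩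
  simp [extend, h2, armZ_zero]

/-! ### Lower bounds for the eigenspaces of a subdivision -/

/-- `T_n(t) + (P - 1) T_{n-1}(t)` for `n = L + 2`, in terms of Chebyshev polynomials of the second
kind. -/
def sVal (P t : ℝ) : ℝ :=
  t * cU t (L + 1) - cU t L + (P - 1) * (cU t (L + 1) - t * cU t L)

theorem cU_rel (t : ℝ) : cU t (L + 1) ^ 2 - 2 * t * cU t (L + 1) * cU t L + cU t L ^ 2 = 1 := by
  have := cU_sq t (L + 1)
  push_cast at this
  rwa [add_sub_cancel_right] at this

theorem cU_pred (t : ℝ) : cU t (L - 1) = 2 * t * cU t L - cU t (L + 1) := by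
  have h := cU_add_two t (L - 1)
  rw [show (L : ℤ) - 1 + 2 = L + 1 by ring, show (L : ℤ) - 1 + 1 = L by ring] at h
  linarith

/-- With `u = U_{n-1}`, `v = U_{n-2}`, the central cell requires `(u+v) b - 2 v f` to have one value
`z` on all arms of a cell, with `s z` the sum of the inner spine values. Solving, `z` is the cell
sum divided by `S`, whence `b - f` is (cell sum) `- S (u-v) f` divided by `S (u+v)`: the flux is
proportional to the equation for `s'`. Injectivity holds because `f` is the restriction of its
extension. -/
theorem finrank_eigen_le_refine (X : CellSystem Q) (t s s' : ℝ)
    (hs : s = t + Fintype.card Q - 1) (hA : cU t (L + 1) + cU t L ≠ 0)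
    (hS : sVal L (Fintype.card Q) t ≠ 0)
    (hs' : s' = sVal L (Fintype.card Q) t * (cU t (L + 1) - cU t L)) :
    finrank ℝ (X.eigen s') ≤ finrank ℝ ((X.refine L τ hτ).eigen s) := by
  set u := cU t (L + 1) with hu
  set v := cU t L with hv
  set S := sVal L (Fintype.card Q) t with hSdef
  let b : (X.V → ℝ) → X.C → Q → ℝ := fun f w i =>
    (X.cellSum f w / S + 2 * v * f (X.corner w i)) / (u + v)
  have hbadd : ∀ f f', b (f + f') = b f + b f' := by
    intro f f'
    funext w i
    simp only [b, cellSum, Pi.add_apply, Finset.sum_add_distrib]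
    ring
  have hbsmul : ∀ (c : ℝ) f, b (c • f) = c • b f := by
    intro c f
    funext w i
    simp only [b, cellSum, Pi.smul_apply, smul_eq_mul, ← Finset.mul_sum]
    ring
  have hmem : ∀ f ∈ X.eigen s', X.extend L τ hτ t f (b f) ∈ (X.refine L τ hτ).eigen s := by
    intro f hf
    have hrel := cU_rel L t
    rw [← hu, ← hv] at hrel
    refine X.extend_mem_eigen L τ hτ t s hs f (b f) hf.1 (fun w i => ?_) (fun g hg => ?_)
    · have e1 : ∀ i, armZ t (f (X.corner w i)) (b f w i) (L + 1) = X.cellSum f w / S := by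
        intro i
        rw [armZ_last, ← hu, ← hv]
        simp only [b]
        field_simp
        ring
      rw [e1]
      have e2 : ∀ k, armY t (f (X.corner w k)) (b f w k) (L + 1) =
          (t + 1) * v / ((u + v) * S) * X.cellSum f w + 1 / (u + v) * f (X.corner w k) := by
        intro k
        rw [armY_last, ← hv, cU_pred, ← hu, ← hv]
        simp only [b]
        field_simp
        linear_combination (S * f (X.corner w k)) * hrel
      simp_rw [e2]
      rw [Finset.sum_add_distrib, Finset.sum_const, ← Finset.mul_sum, ← cellSum_def,
        Finset.card_univ, nsmul_eq_mul]
      -- In this form `S` is the coefficient of `z` once `b` is eliminated from the central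
      -- equation.
      have hSv : S = s * (u + v) - Fintype.card Q * (t + 1) * v := by
        rw [hSdef, sVal, ← hu, ← hv, hs]; ring
      field_simp
      linear_combination (-X.cellSum f w) * hSv
    · have h := hf.2 g hg
      have e : ∀ w i, (b f w i - f (X.corner w i)) * g (X.corner w i) =
          1 / (S * (u + v)) * ((X.cellSum f w - s' * f (X.corner w i)) * g (X.corner w i)) := by
        intro w i
        simp only [b, hs']
        field_simp
        ring
      simp_rw [e, ← Finset.mul_sum]
      rw [form] at h
      rw [h, mul_zero]
  let Φ : X.eigen s' →ₗ[ℝ] (X.refine L τ hτ).eigen s :=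
    { toFun := fun f => ⟨X.extend L τ hτ t f (b f), hmem f f.2⟩
      map_add' := fun f f' => by
        ext1
        simp only [Submodule.coe_add, hbadd, extend_add]
      map_smul' := fun c f => by
        ext1
        simp only [Submodule.coe_smul, hbsmul, extend_smul, RingHom.id_apply] }
  refine LinearMap.finrank_le_finrank_of_injective (f := Φ) fun f f' h => ?_
  ext v
  exact congrFun (congrArg Subtype.val h) (Sum.inl v)

/-- At `s = 0` vanishing boundary values and cell sums suffice, so it is enough to count linear
conditions. -/
theorem card_le_finrank_eigen_zero (X : CellSystem Q) :
    Fintype.card X.V ≤ finrank ℝ (X.eigen 0) + Fintype.card Q + Fintype.card X.C := by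
  let Φ : (X.V → ℝ) →ₗ[ℝ] (Q → ℝ) × (X.C → ℝ) :=
    { toFun := fun f => (fun a => f (X.bdry a), X.cellSum f)
      map_add' := fun f f' => by
        ext <;> simp [cellSum, Finset.sum_add_distrib]
      map_smul' := fun c f => by
        ext <;> simp [cellSum, Finset.mul_sum] }
  have h1 := LinearMap.finrank_range_add_finrank_ker Φ
  have h2 := Submodule.finrank_le (LinearMap.range Φ)
  have h3 : LinearMap.ker Φ ≤ X.eigen 0 := by
    intro f hf
    have hf' : Φ f = 0 := hf
    refine ⟨fun a => congrFun (congrArg Prod.fst hf') a, fun g _ => ?_⟩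
    have h4 : ∀ w, X.cellSum f w = 0 := fun w => congrFun (congrArg Prod.snd hf') w
    simp [form, h4]
  have h4 := Submodule.finrank_mono h3
  rw [Module.finrank_prod, Module.finrank_fintype_fun_eq_card,
    Module.finrank_fintype_fun_eq_card] at h2
  rw [Module.finrank_fintype_fun_eq_card] at h1
  omega

-- If `U_{n-1} + U_{n-2} = 0` and `f = 0`, the last value `z_{L+1}` is 0 for every `b`. The central
-- cells then only need `b` to sum to zero in each old cell, and the old vertices need it to sum to
-- zero at each interior vertex.
open Classical in
theorem le_finrank_refine_of_resonance (hQ : 3 ≤ Fintype.card Q) (X : CellSystem Q)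
    (hX : Function.Injective X.bdry) (t s : ℝ)
    (hs : s = t + Fintype.card Q - 1) (hA : cU t (L + 1) + cU t L = 0) :
    Fintype.card Q * Fintype.card X.C + Fintype.card Q ≤
      finrank ℝ ((X.refine L τ hτ).eigen s) + Fintype.card X.C + Fintype.card X.V := by
  let I := {v : X.V // v ∉ Set.range X.bdry}
  let Φ : (X.C → Q → ℝ) →ₗ[ℝ] (X.C → ℝ) × (I → ℝ) :=
    { toFun := fun b => (fun w => ∑ a, b w a,
        fun v => ∑ w, ∑ a, if X.corner w a = v then b w a else 0)
      map_add' := fun f f' => by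
        ext
        · simp [Finset.sum_add_distrib]
        · simp only [Pi.add_apply, Prod.mk_add_mk, ← Finset.sum_add_distrib]
          refine Finset.sum_congr rfl fun w _ => Finset.sum_congr rfl fun a _ => ?_
          split_ifs <;> simp
      map_smul' := fun c f => by
        ext
        · simp [Finset.mul_sum]
        · simp [Finset.mul_sum] }
  have h1 := LinearMap.finrank_range_add_finrank_ker Φ
  have h2 := Submodule.finrank_le (LinearMap.range Φ)
  have hmem : ∀ b ∈ LinearMap.ker Φ,
      X.extend L τ hτ t 0 b ∈ (X.refine L τ hτ).eigen s := by
    intro b hb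
    have hb' : Φ b = 0 := hb
    have hb1 : ∀ w, ∑ a, b w a = 0 := fun w => congrFun (congrArg Prod.fst hb') w
    have hb2 : ∀ v : I, (∑ w, ∑ a, if X.corner w a = v then b w a else 0) = 0 :=
      fun v => congrFun (congrArg Prod.snd hb') v
    refine X.extend_mem_eigen L τ hτ t s hs 0 b (fun _ => rfl) (fun w i => ?_) (fun g hg => ?_)
    · simp only [armZ_last, armY_last, hA, Pi.zero_apply, mul_zero, sub_zero, zero_mul]
      rw [← Finset.mul_sum, hb1, mul_zero]
    · have e : ∀ w i, (b w i - (0 : X.V → ℝ) (X.corner w i)) * g (X.corner w i) =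
          ∑ v, (if X.corner w i = v then b w i else 0) * g v := by
        intro w i
        simp
      simp_rw [e]
      rw [Finset.sum_congr rfl fun w _ => Finset.sum_comm, Finset.sum_comm]
      refine Finset.sum_eq_zero fun v _ => ?_
      simp_rw [← Finset.sum_mul]
      by_cases hv : v ∈ Set.range X.bdry
      · obtain ⟨a, rfl⟩ := hv
        rw [hg, mul_zero]
      · rw [hb2 ⟨v, hv⟩, zero_mul]
  let Ψ : LinearMap.ker Φ →ₗ[ℝ] (X.refine L τ hτ).eigen s :=
    { toFun := fun b => ⟨X.extend L τ hτ t 0 b, hmem b b.2⟩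
      map_add' := fun f f' => by
        ext1
        have := X.extend_add L τ hτ t 0 0 f f'
        rw [add_zero] at this
        exact this
      map_smul' := fun c f => by
        ext1
        have := X.extend_smul L τ hτ t c 0 f
        rw [smul_zero] at this
        exact this }
  have h3 : finrank ℝ (LinearMap.ker Φ) ≤ finrank ℝ ((X.refine L τ hτ).eigen s) := by
    refine LinearMap.finrank_le_finrank_of_injective (f := Ψ) fun f f' h => ?_
    ext w i
    obtain ⟨v, hv⟩ := extend_free L τ hτ hQ X t 0 w i
    rw [← hv f, ← hv f']
    exact congrFun (congrArg Subtype.val h) v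
  have hI : Fintype.card I = Fintype.card X.V - Fintype.card Q := by
    rw [Fintype.card_subtype_compl]
    congr 1
    exact (Fintype.card_congr (Equiv.ofInjective _ hX)).symm
  have hle := Fintype.card_le_of_injective _ hX
  rw [Module.finrank_prod, Module.finrank_fintype_fun_eq_card,
    Module.finrank_fintype_fun_eq_card, hI] at h2
  have h5 : finrank ℝ (X.C → Q → ℝ) = Fintype.card X.C * Fintype.card Q := by
    simp [Module.finrank_pi_fintype]
  rw [h5, mul_comm] at h1
  omega

/-- The system with a single cell all of whose corners are boundary vertices. -/
abbrev base (Q : Type) [Fintype Q] : CellSystem Q where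
  V := Q
  C := Unit
  corner _ a := a
  bdry a := a

/-- With `f = 0` and `b = 1` the central condition reads exactly `S = 0`. The old vertices impose
nothing, since all of them are boundary vertices. -/
theorem one_le_finrank_refine_base (hQ : 3 ≤ Fintype.card Q) (t s : ℝ)
    (hs : s = t + Fintype.card Q - 1) (hS : sVal L (Fintype.card Q) t = 0) :
    1 ≤ finrank ℝ (((base Q).refine L τ hτ).eigen s) := by
  have hmem : (base Q).extend L τ hτ t 0 1 ∈ ((base Q).refine L τ hτ).eigen s := by
    refine (base Q).extend_mem_eigen L τ hτ t s hs 0 1 (fun _ => rfl) (fun w i => ?_)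
      (fun g hg => ?_)
    · simp only [armZ_last, armY_last, Pi.zero_apply, Pi.one_apply, mul_zero, sub_zero, mul_one,
        Finset.sum_const, Finset.card_univ, nsmul_eq_mul]
      rw [sVal] at hS
      rw [hs]
      linear_combination hS
    · exact Finset.sum_eq_zero fun w _ => Finset.sum_eq_zero fun i _ => by
        rw [show g ((base Q).corner w i) = 0 from hg i, mul_zero]
  have : Nonempty Q := Fintype.card_pos_iff.mp (by omega)
  obtain ⟨i⟩ := this
  obtain ⟨v, hv⟩ := extend_free L τ hτ hQ (base Q) t 0 () i
  have : Nontrivial (((base Q).refine L τ hτ).eigen s) := by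
    refine ⟨⟨⟨_, hmem⟩, 0, fun h => ?_⟩⟩
    have h1 : (base Q).extend L τ hτ t 0 1 v = 0 := congrFun (congrArg Subtype.val h) v
    rw [hv] at h1
    exact one_ne_zero h1
  exact Nat.one_le_iff_ne_zero.mpr Module.finrank_pos.ne'

/-! ### Counting vertices and cells -/

theorem card_refine_V (X : CellSystem Q) : Fintype.card (X.refine L τ hτ).V =
    Fintype.card X.V + Fintype.card X.C *
      (Fintype.card Q * (L + 1) * (Fintype.card Q - 1)) := by
  have h : Fintype.card (NewVertex Q L) = Fintype.card Q * (L + 1) * (Fintype.card Q - 1) := by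
    let e : NewVertex Q L ≃ Σ p : Q × Fin (L + 1), {a : Q // a ≠ p.1} :=
      { toFun := fun p => ⟨(p.1.1, p.1.2.1), ⟨p.1.2.2, p.2⟩⟩
        invFun := fun p => ⟨(p.1.1, p.1.2, p.2.1), p.2.2⟩
        left_inv := fun _ => rfl
        right_inv := fun _ => rfl }
    rw [Fintype.card_congr e, Fintype.card_sigma]
    simp [Fintype.card_subtype_compl]
  rw [← h]
  exact (Fintype.card_sum).trans (by rw [Fintype.card_prod])

theorem card_refine_C (X : CellSystem Q) : Fintype.card (X.refine L τ hτ).C =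
    Fintype.card X.C * (Fintype.card Q * (L + 1) + 1) := by
  exact (Fintype.card_prod _ _).trans (by simp)

end CellSystem

open CellSystem Module

/-! ### Integer coordinates: the combinatorial model embeds in a grid -/

section Geometry

/-- The corner opposite to `a`. -/
def opp {d : ℕ} (a : Fin d → Bool) : Fin d → Bool := fun k => !a k

theorem opp_ne {d : ℕ} [NeZero d] (a : Fin d → Bool) : opp a ≠ a := fun h => by
  have := congrFun h 0
  simp [opp] at this

variable (L d : ℕ) [NeZero d]

/-- The combinatorial model of the level-`m` graph for `n = L + 2`. -/
def level : ℕ → CellSystem (Fin d → Bool)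
  | 0 => base _
  | m + 1 => (level m).refine L opp opp_ne

/-- The integer coordinates of a corner. -/
def bit {d : ℕ} (a : Fin d → Bool) (k : Fin d) : ℤ := if a k then 1 else 0

variable {L d} in
/-- The position of a subcell in the cube of side `2 L + 3`. -/
def digit : Option ((Fin d → Bool) × Fin (L + 1)) → Fin d → ℤ
  | none, _ => L + 1
  | some (i, j), k => if i k then 2 * L + 2 - j else j

/-- The integer position of a cell. -/
def off : (m : ℕ) → (level L d m).C → Fin d → ℤ
  | 0, _, _ => 0
  | m + 1, (w, σ), k => (2 * L + 3) * off m w k + digit σ k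

/-- The integer position of a vertex. -/
def pos : (m : ℕ) → (level L d m).V → Fin d → ℤ
  | 0, a, k => bit a k
  | m + 1, Sum.inl v, k => (2 * L + 3) * pos m v k
  | m + 1, Sum.inr (w, ⟨(i, j, a), _⟩), k =>
      (2 * L + 3) * off L d m w k + digit (some (i, j)) k + bit a k

theorem bit_cases {d : ℕ} (a : Fin d → Bool) (k : Fin d) :
    (a k = true ∧ bit a k = 1) ∨ (a k = false ∧ bit a k = 0) := by
  unfold bit; cases a k <;> simp

theorem bit_injective {d : ℕ} : Function.Injective (bit (d := d)) := by
  intro a b h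
  funext k
  have := congrFun h k
  rcases bit_cases a k with h1 | h1 <;> rcases bit_cases b k with h2 | h2 <;>
    simp_all

theorem pos_spine (m : ℕ) (w : (level L d m).C) (i : Fin d → Bool)
    (hw : pos L d m ((level L d m).corner w i) = off L d m w + bit i) (j : Fin (L + 2)) (k : Fin d) :
    pos L d (m + 1) ((level L d m).spine (L := L) opp_ne w i j) k =
      (2 * L + 3) * off L d m w k + (if i k then 2 * L + 3 - (j : ℤ) else j) := by
  cases j using Fin.cases with
  | zero =>
    change (2 * L + 3) * pos L d m ((level L d m).corner w i) k = _
    rw [hw]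
    rcases bit_cases i k with h | h <;> simp [h.1, h.2] <;> ring
  | succ j =>
    change (2 * L + 3) * off L d m w k + digit (some (i, j)) k + bit (opp i) k = _
    rcases bit_cases i k with h | h <;> (simp [h.1, digit, bit, opp]; ring)

theorem pos_corner (m : ℕ) (w : (level L d m).C) (a : Fin d → Bool) :
    pos L d m ((level L d m).corner w a) = off L d m w + bit a := by
  induction m generalizing a with
  | zero =>
    funext k
    change bit a k = 0 + bit a k
    ring
  | succ m ih =>
    funext k
    obtain ⟨w, σ⟩ := w
    rcases σ with _ | ⟨i, j⟩
    · change pos L d (m + 1) ((level L d m).spine (L := L) opp_ne w a (Fin.last _)) k =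
        (2 * L + 3) * off L d m w k + (L + 1) + bit a k
      rw [pos_spine L d m w a (ih w a)]
      rcases bit_cases a k with h | h <;> simp [h.1, h.2] <;> ring
    · by_cases h : a = i
      · subst h
        have e : (level L d (m + 1)).corner (w, some (a, j)) a =
          (level L d m).spine (L := L) opp_ne w a j.castSucc := dif_pos rfl
        change _ = (2 * L + 3) * off L d m w k + digit (some (a, j)) k + bit a k
        refine (congrFun (congrArg (pos L d (m + 1)) e) k).trans ?_
        rw [pos_spine L d m w a (ih w a)]
        rcases bit_cases a k with h | h <;> simp [h.1, h.2, digit] <;> ring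
      · have e : (level L d (m + 1)).corner (w, some (i, j)) a =
          Sum.inr (w, ⟨(i, j, a), h⟩) := dif_neg h
        exact congrFun (congrArg (pos L d (m + 1)) e) k

theorem digit_bounds (σ : Option ((Fin d → Bool) × Fin (L + 1))) (k : Fin d) :
    0 ≤ digit σ k ∧ digit σ k ≤ 2 * L + 2 := by
  rcases σ with _ | ⟨i, j⟩
  · simp only [digit]; omega
  · have := j.isLt
    simp only [digit]
    split_ifs <;> omega

theorem digit_parity (σ : Option ((Fin d → Bool) × Fin (L + 1))) (k k' : Fin d) :
    digit σ k % 2 = digit σ k' % 2 := by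
  rcases σ with _ | ⟨i, j⟩
  · rfl
  · simp only [digit]
    split_ifs <;> omega

theorem digit_injective : Function.Injective (digit (L := L) (d := d)) := by
  intro σ σ' h
  rcases σ with _ | ⟨i, j⟩ <;> rcases σ' with _ | ⟨i', j'⟩
  · rfl
  · have := congrFun h 0
    have := j'.isLt
    simp only [digit] at *
    split_ifs at * <;> omega
  · have := congrFun h 0
    have := j.isLt
    simp only [digit] at *
    split_ifs at * <;> omega
  · have h1 := j.isLt
    have h2 := j'.isLt
    have hi : i = i' := by
      funext k
      have := congrFun h k
      simp only [digit] at this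
      cases h3 : i k <;> cases h4 : i' k <;> simp [h3, h4] at this ⊢ <;> omega
    subst hi
    have := congrFun h 0
    simp only [digit] at this
    have hj : j = j' := by
      ext
      split_ifs at this <;> omega
    rw [hj]

/-- Subcells sit on the diagonals, where coordinates are `j` or `2L + 2 - j`, and the scaling factor
`2L + 3` is odd, so equality of parities survives subdivision. -/
theorem off_parity (m : ℕ) (w : (level L d m).C) (k k' : Fin d) :
    off L d m w k % 2 = off L d m w k' % 2 := by
  induction m with
  | zero => rfl
  | succ m ih =>
    obtain ⟨w, σ⟩ := w
    have h1 := ih w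
    have h2 := digit_parity L d σ k k'
    change ((2 * L + 3) * off L d m w k + digit σ k) % 2 =
      ((2 * L + 3) * off L d m w k' + digit σ k') % 2
    have e : ∀ x : ℤ, (2 * L + 3) * x = 2 * ((L + 1) * x) + x := fun x => by ring
    rw [e, e]
    omega

theorem eq_of_scaled_eq {x y δ ε : ℤ} (hδ : 0 ≤ δ ∧ δ ≤ 2 * L + 2) (hε : 0 ≤ ε ∧ ε ≤ 2 * L + 2)
    (h : (2 * L + 3) * x + δ = (2 * L + 3) * y + ε) : x = y := by
  rcases lt_trichotomy x y with h1 | h1 | h1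
  · nlinarith
  · exact h1
  · nlinarith

theorem off_injective (m : ℕ) : Function.Injective (off L d m) := by
  induction m with
  | zero => intro w w' _; rfl
  | succ m ih =>
    rintro ⟨w, σ⟩ ⟨w', σ'⟩ h
    have h1 : ∀ k, (2 * L + 3) * off L d m w k + digit σ k =
      (2 * L + 3) * off L d m w' k + digit σ' k := fun k => congrFun h k
    have h2 : off L d m w = off L d m w' := funext fun k =>
      eq_of_scaled_eq L (digit_bounds L d σ k) (digit_bounds L d σ' k) (h1 k)
    have h3 : digit σ = digit σ' := funext fun k => by
      have := h1 k
      rw [h2] at this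
      omega
    rw [ih h2, digit_injective L d h3]

/-- Two cells at sup-distance at most one coincide or are diagonal neighbours. -/
theorem off_eq_or (m : ℕ) (w w' : (level L d m).C)
    (h : ∀ k, |off L d m w k - off L d m w' k| ≤ 1) :
    w = w' ∨ ∀ k, |off L d m w k - off L d m w' k| = 1 := by
  by_cases h0 : ∃ k, off L d m w k = off L d m w' k
  · left
    obtain ⟨k0, h0⟩ := h0
    refine off_injective L d m (funext fun k => ?_)
    have h1 := off_parity L d m w k k0
    have h2 := off_parity L d m w' k k0
    have h3 := abs_le.mp (h k)
    omega
  · right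
    intro k
    have h3 := abs_le.mp (h k)
    have : off L d m w k ≠ off L d m w' k := fun h => h0 ⟨k, h⟩
    rcases abs_cases (off L d m w k - off L d m w' k) with h | h <;> omega

/-- An edge determines its cell: by the parity argument distinct touching cells are diagonal
neighbours and share only one point. -/
theorem corner_eq_corner (m : ℕ) {w w' : (level L d m).C} {a a' b b' : Fin d → Bool} (hab : a ≠ b)
    (h1 : off L d m w + bit a = off L d m w' + bit a')
    (h2 : off L d m w + bit b = off L d m w' + bit b') : w = w' ∧ a = a' ∧ b = b' := by
  have hw : w = w' := by
    rcases off_eq_or L d m w w' (fun k => by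
      have := congrFun h1 k
      simp only [Pi.add_apply] at this
      rcases bit_cases a k with h | h <;> rcases bit_cases a' k with h' | h' <;>
        rw [abs_le] <;> omega) with h | h
    · exact h
    · refine absurd ?_ hab
      funext k
      have e1 := congrFun h1 k
      have e2 := congrFun h2 k
      have e3 := h k
      simp only [Pi.add_apply] at e1 e2
      have e4 : off L d m w k ≠ off L d m w' k := fun h => by simp [h] at e3
      rcases bit_cases a k with h | h <;> rcases bit_cases b k with h' | h' <;>
        rcases bit_cases a' k with h3 | h3 <;> rcases bit_cases b' k with h4 | h4 <;>
        first
          | exact h.1.trans h'.1.symm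
          | (exfalso; omega)
  subst hw
  exact ⟨rfl, bit_injective (add_left_cancel h1), bit_injective (add_left_cancel h2)⟩

theorem corner_surjective (m : ℕ) (v : (level L d m).V) :
    ∃ w a, (level L d m).corner w a = v := by
  induction m with
  | zero => exact ⟨(), v, rfl⟩
  | succ m ih =>
    rcases v with v | ⟨w, ⟨⟨i, j, a⟩, h⟩⟩
    · obtain ⟨w, a, rfl⟩ := ih v
      refine ⟨(w, some (a, 0)), a, ?_⟩
      exact dif_pos rfl
    · refine ⟨(w, some (i, j)), a, ?_⟩
      exact dif_neg h

/-- `ε` is the position of the same point relative to `w'`. Were `w ≠ w'`, they would be diagonal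
neighbours, so the point would be extreme (0 or `2L + 3`) in every coordinate of `w`. This forces it
to be the old corner `i`, contradicting `a ≠ i`. -/
theorem new_not_corner (m : ℕ) (w w' : (level L d m).C) (i a : Fin d → Bool) (j : Fin (L + 1))
    (ha : a ≠ i) (ε : Fin d → ℤ) (hε : ∀ k, 0 ≤ ε k ∧ ε k ≤ 2 * L + 3)
    (h : ∀ k, (2 * L + 3) * off L d m w k + digit (some (i, j)) k + bit a k =
      (2 * L + 3) * off L d m w' k + ε k) : w = w' := by
  have hb : ∀ k, 0 ≤ digit (some (i, j)) k + bit a k ∧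
      digit (some (i, j)) k + bit a k ≤ 2 * L + 3 := fun k => by
    have := digit_bounds L d (some (i, j)) k
    rcases bit_cases a k with h | h <;> omega
  rcases off_eq_or L d m w w' (fun k => by
    have h1 := h k
    have h2 := hb k
    have h3 := hε k
    rw [abs_le]
    constructor <;> nlinarith) with h1 | h1
  · exact h1
  · refine absurd (funext fun k => ?_) ha
    have h2 := h k
    have h3 := hb k
    have h4 := hε k
    have h5 := j.isLt
    have h6 : digit (some (i, j)) k + bit a k = 0 ∨
        digit (some (i, j)) k + bit a k = 2 * L + 3 := by
      rcases eq_or_eq_neg_of_abs_eq (h1 k) with e | e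
      · left; nlinarith
      · right; nlinarith
    simp only [digit] at h6
    rcases bit_cases a k with h | h <;> cases h7 : i k <;>
      simp only [h.1, h.2, h7, if_true, Bool.false_eq_true, if_false] at h6 ⊢ <;> omega

/-- Each coordinate of a vertex of arm `i` is at most `L + 1` or at least `L + 2` according to the
bit of `i`, so `i` can be read off. If `j ≠ j'`, the vertex would be the corner `i` of the inner of
the two cells, which is excluded. -/
theorem digit_add_bit_injective {i i' a a' : Fin d → Bool} {j j' : Fin (L + 1)} (ha : a ≠ i)
    (ha' : a' ≠ i') (h : ∀ k, digit (some (i, j)) k + bit a k = digit (some (i', j')) k + bit a' k) :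
    i = i' ∧ j = j' ∧ a = a' := by
  have hj := j.isLt
  have hj' := j'.isLt
  have hi : i = i' := by
    funext k
    have h1 := h k
    simp only [digit] at h1
    rcases bit_cases a k with h2 | h2 <;> rcases bit_cases a' k with h3 | h3 <;>
      cases h4 : i k <;> cases h5 : i' k <;>
      simp only [h2.2, h3.2, h4, h5, if_true, Bool.false_eq_true, if_false] at h1 ⊢ <;> omega
  subst hi
  have hjj : j = j' := by
    by_contra hne
    have hne' : (j : ℕ) ≠ j' := fun h => hne (Fin.ext h)
    have hcase : (∀ k, a' k = i k) ∨ ∀ k, a k = i k := by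
      rcases lt_or_gt_of_ne hne' with hlt | hlt
      · left
        intro k
        have h1 := h k
        simp only [digit] at h1
        rcases bit_cases a k with h2 | h2 <;> rcases bit_cases a' k with h3 | h3 <;>
          cases h4 : i k <;>
          simp only [h2.2, h3.2, h3.1, h4, if_true, Bool.false_eq_true, if_false] at h1 ⊢ <;> omega
      · right
        intro k
        have h1 := h k
        simp only [digit] at h1
        rcases bit_cases a k with h2 | h2 <;> rcases bit_cases a' k with h3 | h3 <;>
          cases h4 : i k <;>
          simp only [h2.2, h2.1, h3.2, h4, if_true, Bool.false_eq_true, if_false] at h1 ⊢ <;> omega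
    rcases hcase with h1 | h1
    · exact ha' (funext h1)
    · exact ha (funext h1)
  subst hjj
  exact ⟨rfl, rfl, bit_injective (funext fun k => by have := h k; omega)⟩

theorem pos_injective (m : ℕ) : Function.Injective (pos L d m) := by
  induction m with
  | zero => exact fun a b h => bit_injective h
  | succ m ih =>
    have hmixed : ∀ (v : (level L d m).V) (w : (level L d m).C) (i a : Fin d → Bool)
        (j : Fin (L + 1)), a ≠ i → ¬ ∀ k, (2 * L + 3) * pos L d m v k =
          (2 * L + 3) * off L d m w k + digit (some (i, j)) k + bit a k := by
      intro v w i a j ha h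
      obtain ⟨w', b, rfl⟩ := corner_surjective L d m v
      rw [pos_corner] at h
      have hw : w = w' := new_not_corner L d m w w' i a j ha (fun k => (2 * L + 3) * bit b k)
        (fun k => by rcases bit_cases b k with h | h <;> rw [h.2] <;> constructor <;> omega)
        (fun k => by rw [← h k, Pi.add_apply]; ring)
      subst hw
      refine ha (funext fun k => ?_)
      have h1 := h k
      have hj := j.isLt
      simp only [digit, Pi.add_apply, mul_add] at h1
      rcases bit_cases a k with h2 | h2 <;> rcases bit_cases b k with h3 | h3 <;>
          cases h4 : i k <;>
          simp only [h2.2, h2.1, h3.2, h4, if_true, Bool.false_eq_true, if_false] at h1 ⊢ <;> omega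
    rintro (v | ⟨w, ⟨⟨i, j, a⟩, ha⟩⟩) (v' | ⟨w', ⟨⟨i', j', a'⟩, ha'⟩⟩) h
    · have : pos L d m v = pos L d m v' := funext fun k => by
        have h1 : (2 * (L : ℤ) + 3) * pos L d m v k = (2 * L + 3) * pos L d m v' k := congrFun h k
        have h0 : (2 * (L : ℤ) + 3) ≠ 0 := by omega
        exact mul_left_cancel₀ h0 h1
      rw [ih this]
    · exact absurd (fun k => congrFun h k) (hmixed v w' i' a' j' ha')
    · exact absurd (fun k => (congrFun h k).symm) (hmixed v' w i a j ha)
    · have h1 : ∀ k, (2 * L + 3) * off L d m w k + digit (some (i, j)) k + bit a k =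
        (2 * L + 3) * off L d m w' k + digit (some (i', j')) k + bit a' k := fun k => congrFun h k
      have hw : w = w' := new_not_corner L d m w w' i a j ha
        (fun k => digit (some (i', j')) k + bit a' k) (fun k => by
          have := digit_bounds L d (some (i', j')) k
          rcases bit_cases a' k with h | h <;> omega) (fun k => by rw [h1 k]; ring)
      subst hw
      obtain ⟨rfl, rfl, rfl⟩ := digit_add_bit_injective L d (i := i) (i' := i') (a := a)
        (a' := a') (j := j) (j' := j') ha ha' fun k => by
          have := h1 k
          omega
      rfl

theorem pos_bdry (m : ℕ) (a : Fin d → Bool) (k : Fin d) :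
    pos L d m ((level L d m).bdry a) k = (2 * L + 3) ^ m * bit a k := by
  induction m with
  | zero =>
    change bit a k = _
    simp
  | succ m ih =>
    change (2 * L + 3) * pos L d m ((level L d m).bdry a) k = _
    rw [ih]
    ring

theorem sum_finrank_le {ι V : Type*} [AddCommGroup V] [Module ℝ V] [FiniteDimensional ℝ V]
    (E : ι → Submodule ℝ V) (hE : iSupIndep E) (K : Submodule ℝ V) (hK : ∀ i, E i ≤ K)
    (F : Finset ι) : ∑ i ∈ F, finrank ℝ (E i) ≤ finrank ℝ K := by
  classical
  have h : ∑ i ∈ F, finrank ℝ (E i) = finrank ℝ (⨆ i ∈ (F : Set ι), E i : Submodule ℝ V) := by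
    induction F using Finset.induction_on with
    | empty =>
      rw [Finset.sum_empty, Finset.coe_empty, iSup_emptyset, finrank_bot]
    | insert i F hi ih =>
      rw [Finset.sum_insert hi, ih, Finset.coe_insert, iSup_insert]
      have h1 := Submodule.finrank_sup_add_finrank_inf_eq (E i) (⨆ j ∈ (F : Set ι), E j)
      have h2 : Disjoint (E i) (⨆ j ∈ (F : Set ι), E j) := hE.disjoint_biSup (by simpa using hi)
      rw [h2.eq_bot, finrank_bot] at h1
      omega
  rw [h]
  exact Submodule.finrank_mono (iSup₂_le fun i _ => hK i)

/-! ### Comparison of the model with the iterated function system -/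

/-- The point of `ℝ^d` with given integer coordinates at level `m`. -/
def pt (m : ℕ) (x : Fin d → ℤ) : Fin d → ℝ := fun k => x k / (2 * L + 3) ^ m

theorem pt_injective (m : ℕ) : Function.Injective (pt L d m) := by
  intro x y h
  funext k
  have h1 : (x k : ℝ) / (2 * L + 3) ^ m = y k / (2 * L + 3) ^ m := congrFun h k
  have h2 : ((2 * L + 3 : ℝ)) ^ m ≠ 0 := by positivity
  exact_mod_cast (div_left_inj' h2).mp h1

theorem pt_scale (m : ℕ) (x : Fin d → ℤ) (y : Fin d → ℤ)
    (h : ∀ k, y k = (2 * L + 3) ^ m * x k) : pt L d m y = fun k => (x k : ℝ) := by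
  funext k
  have h2 : ((2 * L + 3 : ℝ)) ^ m ≠ 0 := by positivity
  rw [pt, h]
  push_cast
  field_simp

theorem corner_eq_bit (a : Fin d → Bool) : corner a = fun k => ((bit a k : ℤ) : ℝ) := by
  funext k
  rcases bit_cases a k with h | h <;> simp [corner, h.1, h.2]

theorem contraction_pt_some (m : ℕ) (i : Fin d → Bool) (j : Fin (L + 1)) (x : Fin d → ℤ) :
    contraction (L + 2) i (j + 1) (pt L d m x) =
      pt L d (m + 1) (fun k => x k + (2 * L + 3) ^ m * digit (some (i, j)) k) := by
  funext k
  have h1 : (2 * ((L : ℝ) + 2) - 1) ≠ 0 := by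
    have : (0 : ℝ) ≤ L := L.cast_nonneg
    intro h; linarith
  have h2 : (2 * (L : ℝ) + 3) ≠ 0 := by positivity
  have h3 : ((L : ℝ) + 2 - 1) ≠ 0 := by
    have : (0 : ℝ) ≤ L := L.cast_nonneg
    intro h; linarith
  have h4 : (2 * ((L : ℝ) + 2) - 1) = 2 * L + 3 := by ring
  simp only [contraction, pt, center, corner, digit, Pi.add_apply, Pi.smul_apply, smul_eq_mul]
  push_cast
  rw [h4] at *
  cases i k <;> simp <;> field_simp <;> ring

/-- At `j = n` the weight of the corner vanishes, so the maps `F_{i,n}` all coincide and give the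
one central cell. -/
theorem contraction_pt_none (m : ℕ) (i : Fin d → Bool) (x : Fin d → ℤ) :
    contraction (L + 2) i (L + 2) (pt L d m x) =
      pt L d (m + 1) (fun k => x k + (2 * L + 3) ^ m * digit (L := L) none k) := by
  funext k
  have h2 : (2 * (L : ℝ) + 3) ≠ 0 := by positivity
  have h3 : ((L : ℝ) + 2 - 1) ≠ 0 := by
    have : (0 : ℝ) ≤ L := L.cast_nonneg
    intro h; linarith
  have h4 : (2 * ((L : ℝ) + 2) - 1) = 2 * L + 3 := by ring
  simp only [contraction, pt, center, corner, digit, Pi.add_apply, Pi.smul_apply, smul_eq_mul]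
  push_cast
  rw [h4] at *
  simp only [sub_self, zero_div, zero_mul, zero_add]
  field_simp
  ring

/-- The contractions prepend a digit at the coarsest scale, whereas subdivision appends one at the
finest. Together with `off_outer_exists` this matches the two recursions. -/
theorem off_outer (m : ℕ) (w : (level L d m).C) (σ : Option ((Fin d → Bool) × Fin (L + 1))) :
    ∃ w', ∀ k, off L d (m + 1) w' k = off L d m w k + (2 * L + 3) ^ m * digit σ k := by
  induction m with
  | zero =>
    refine ⟨((), σ), fun k => ?_⟩
    change (2 * L + 3) * 0 + digit σ k = 0 + _
    ring
  | succ m ih =>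
    obtain ⟨w, σ₀⟩ := w
    obtain ⟨w', h⟩ := ih w
    refine ⟨(w', σ₀), fun k => ?_⟩
    change (2 * L + 3) * off L d (m + 1) w' k + digit σ₀ k =
      ((2 * L + 3) * off L d m w k + digit σ₀ k) + _
    rw [h]
    ring

theorem off_outer_exists (m : ℕ) (w' : (level L d (m + 1)).C) :
    ∃ w, ∃ σ : Option ((Fin d → Bool) × Fin (L + 1)),
      ∀ k, off L d (m + 1) w' k = off L d m w k + (2 * L + 3) ^ m * digit σ k := by
  induction m with
  | zero =>
    obtain ⟨w, σ⟩ := w'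
    refine ⟨w, σ, fun k => ?_⟩
    change (2 * L + 3) * 0 + digit σ k = 0 + _
    ring
  | succ m ih =>
    obtain ⟨w', σ₀⟩ := w'
    obtain ⟨w, σ, h⟩ := ih w'
    refine ⟨(w, σ₀), σ, fun k => ?_⟩
    change (2 * L + 3) * off L d (m + 1) w' k + digit σ₀ k =
      ((2 * L + 3) * off L d m w k + digit σ₀ k) + _
    rw [h]
    ring

theorem exists_digit (i : Fin d → Bool) {j : ℕ} (hj : j ∈ Finset.Icc 1 (L + 2)) :
    ∃ σ, ∀ m x, contraction (L + 2) i j (pt L d m x) =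
      pt L d (m + 1) (fun k => x k + (2 * L + 3) ^ m * digit (L := L) σ k) := by
  rw [Finset.mem_Icc] at hj
  rcases eq_or_lt_of_le hj.2 with h | h
  · subst h
    exact ⟨none, fun m x => contraction_pt_none L d m i x⟩
  · obtain ⟨j, rfl⟩ : ∃ j', j = j' + 1 := ⟨j - 1, by omega⟩
    exact ⟨some (i, ⟨j, by omega⟩), fun m x => contraction_pt_some L d m i ⟨j, by omega⟩ x⟩

theorem exists_contraction (σ : Option ((Fin d → Bool) × Fin (L + 1))) :
    ∃ i, ∃ j ∈ Finset.Icc 1 (L + 2), ∀ m x, contraction (L + 2) i j (pt L d m x) =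
      pt L d (m + 1) (fun k => x k + (2 * L + 3) ^ m * digit (L := L) σ k) := by
  rcases σ with _ | ⟨i, j⟩
  · exact ⟨fun _ => true, L + 2, by simp, fun m x => contraction_pt_none L d m _ x⟩
  · exact ⟨i, j + 1, by simp, fun m x => contraction_pt_some L d m i j x⟩

theorem mem_vertices (m : ℕ) (x : Fin d → ℝ) :
    x ∈ vertices (L + 2) d m ↔ ∃ w a, pt L d m (off L d m w + bit a) = x := by
  induction m generalizing x with
  | zero =>
    have e : ∀ a : Fin d → Bool, pt L d 0 (off L d 0 () + bit a) = corner a := by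
      intro a
      rw [corner_eq_bit]
      exact pt_scale L d 0 (bit a) _ fun k => by
        change 0 + bit a k = _
        ring
    simp only [vertices, Finset.mem_image, Finset.mem_univ, true_and]
    constructor
    · rintro ⟨a, rfl⟩
      exact ⟨(), a, e a⟩
    · rintro ⟨_, a, rfl⟩
      exact ⟨a, (e a).symm⟩
  | succ m ih =>
    simp only [vertices, Finset.mem_biUnion, Finset.mem_univ, true_and, Finset.mem_image]
    constructor
    · rintro ⟨i, j, hj, y, hy, rfl⟩
      obtain ⟨w, a, rfl⟩ := (ih y).mp hy
      obtain ⟨σ, hσ⟩ := exists_digit L d i hj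
      obtain ⟨w', hw'⟩ := off_outer L d m w σ
      refine ⟨w', a, ?_⟩
      rw [hσ]
      congr 1
      funext k
      simp only [Pi.add_apply, hw']
      ring
    · rintro ⟨w', a, rfl⟩
      obtain ⟨w, σ, hw'⟩ := off_outer_exists L d m w'
      obtain ⟨i, j, hj, hσ⟩ := exists_contraction L d σ
      refine ⟨i, j, hj, _, (ih _).mpr ⟨w, a, rfl⟩, ?_⟩
      rw [hσ]
      congr 1
      funext k
      simp only [Pi.add_apply, hw']
      ring

theorem mem_edges (m : ℕ) (e : Sym2 (Fin d → ℝ)) :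
    e ∈ edges (L + 2) d m ↔ ∃ w a b, a ≠ b ∧
      e = s(pt L d m (off L d m w + bit a), pt L d m (off L d m w + bit b)) := by
  induction m generalizing e with
  | zero =>
    have h : ∀ a : Fin d → Bool, pt L d 0 (off L d 0 () + bit a) = corner a := by
      intro a
      rw [corner_eq_bit]
      exact pt_scale L d 0 (bit a) _ fun k => by
        change 0 + bit a k = _
        ring
    simp only [edges, Set.mem_ofPred_eq]
    constructor
    · rintro ⟨a, b, hab, rfl⟩
      exact ⟨(), a, b, hab, by rw [h, h]⟩
    · rintro ⟨w, a, b, hab, rfl⟩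
      refine ⟨a, b, hab, ?_⟩
      rw [← h, ← h]
      rfl
  | succ m ih =>
    simp only [edges, Set.mem_ofPred_eq]
    constructor
    · rintro ⟨i, j, hj, y, hy, rfl⟩
      obtain ⟨w, a, b, hab, rfl⟩ := (ih y).mp hy
      obtain ⟨σ, hσ⟩ := exists_digit L d i hj
      obtain ⟨w', hw'⟩ := off_outer L d m w σ
      refine ⟨w', a, b, hab, ?_⟩
      have e : ∀ a, off L d (m + 1) w' + bit a =
          fun k => (off L d m w + bit a) k + (2 * L + 3) ^ m * digit σ k := fun a => by
        funext k
        simp only [Pi.add_apply, hw']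
        ring
      rw [Sym2.map_mk, hσ, hσ, e, e]
    · rintro ⟨w', a, b, hab, rfl⟩
      obtain ⟨w, σ, hw'⟩ := off_outer_exists L d m w'
      obtain ⟨i, j, hj, hσ⟩ := exists_contraction L d σ
      refine ⟨i, j, hj, _, (ih _).mpr ⟨w, a, b, hab, rfl⟩, ?_⟩
      have e : ∀ a, off L d (m + 1) w' + bit a =
          fun k => (off L d m w + bit a) k + (2 * L + 3) ^ m * digit σ k := fun a => by
        funext k
        simp only [Pi.add_apply, hw']
        ring
      rw [Sym2.map_mk, hσ, hσ, e, e]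

/-- The vertices of the combinatorial model are those of the graph. -/
def vertexEquiv (m : ℕ) : (level L d m).V ≃ vertices (L + 2) d m :=
  Equiv.ofBijective (fun v => ⟨pt L d m (pos L d m v), by
      obtain ⟨w, a, rfl⟩ := corner_surjective L d m v
      rw [mem_vertices, pos_corner]
      exact ⟨w, a, rfl⟩⟩) <| by
    constructor
    · intro v v' h
      exact pos_injective L d m (pt_injective L d m (congrArg Subtype.val h))
    · rintro ⟨x, hx⟩
      obtain ⟨w, a, rfl⟩ := (mem_vertices L d m x).mp hx
      exact ⟨(level L d m).corner w a, Subtype.ext (by simp only [pos_corner])⟩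

theorem vertexEquiv_apply (m : ℕ) (v : (level L d m).V) :
    (vertexEquiv L d m v : Fin d → ℝ) = pt L d m (pos L d m v) := rfl

theorem mem_boundary_iff (m : ℕ) (v : (level L d m).V) :
    (vertexEquiv L d m v : Fin d → ℝ) ∈ vertices (L + 2) d 0 ↔
      ∃ a, (level L d m).bdry a = v := by
  have h : ∀ a, pt L d m (pos L d m ((level L d m).bdry a)) = corner a := fun a => by
    rw [corner_eq_bit]
    exact pt_scale L d m (bit a) _ (pos_bdry L d m a)
  rw [vertexEquiv_apply]
  simp only [vertices, Finset.mem_image, Finset.mem_univ, true_and]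
  constructor
  · rintro ⟨a, ha⟩
    refine ⟨a, pos_injective L d m (pt_injective L d m ?_)⟩
    rw [h, ha]
  · rintro ⟨a, rfl⟩
    exact ⟨a, (h a).symm⟩

theorem bdry_injective (m : ℕ) : Function.Injective (level L d m).bdry := by
  intro a b h
  refine bit_injective (funext fun k => ?_)
  have h1 := congrArg (fun v => pos L d m v k) h
  simp only [pos_bdry] at h1
  have h0 : (2 * (L : ℤ) + 3) ^ m ≠ 0 := by positivity
  exact mul_left_cancel₀ h0 h1

theorem level_corner_eq (m : ℕ) {w w' : (level L d m).C} {a a' b b' : Fin d → Bool} (hab : a ≠ b)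
    (h1 : (level L d m).corner w a = (level L d m).corner w' a')
    (h2 : (level L d m).corner w b = (level L d m).corner w' b') : w = w' ∧ a = a' ∧ b = b' := by
  refine corner_eq_corner L d m hab ?_ ?_
  · rw [← pos_corner, ← pos_corner, h1]
  · rw [← pos_corner, ← pos_corner, h2]

theorem level_corner_injective (m : ℕ) (w : (level L d m).C) :
    Function.Injective ((level L d m).corner w) := by
  intro a b h
  have h1 := congrArg (pos L d m) h
  rw [pos_corner, pos_corner] at h1
  exact bit_injective (add_left_cancel h1)

/-! ### Adjacency, the Laplacian and the weak form -/

theorem adj_iff (m : ℕ) (v v' : (level L d m).V) :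
    (graph (L + 2) d m).Adj (vertexEquiv L d m v) (vertexEquiv L d m v') ↔
      ∃ w a b, a ≠ b ∧ (level L d m).corner w a = v ∧ (level L d m).corner w b = v' := by
  have hpt : ∀ w a, pt L d m (off L d m w + bit a) =
      pt L d m (pos L d m ((level L d m).corner w a)) := fun w a => by rw [pos_corner]
  have hinj : ∀ v v', pt L d m (pos L d m v) = pt L d m (pos L d m v') → v = v' :=
    fun v v' h => pos_injective L d m (pt_injective L d m h)
  simp only [graph, SimpleGraph.comap_adj, SimpleGraph.fromEdgeSet_adj, mem_edges,
    vertexEquiv_apply]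
  constructor
  · rintro ⟨⟨w, a, b, hab, h⟩, -⟩
    rw [hpt, hpt, Sym2.eq_iff] at h
    rcases h with h | h
    · exact ⟨w, a, b, hab, (hinj _ _ h.1).symm, (hinj _ _ h.2).symm⟩
    · exact ⟨w, b, a, hab.symm, (hinj _ _ h.1).symm, (hinj _ _ h.2).symm⟩
  · rintro ⟨w, a, b, hab, rfl, rfl⟩
    refine ⟨⟨w, a, b, hab, by rw [hpt, hpt]⟩, fun h => hab ?_⟩
    exact level_corner_injective L d m w (hinj _ _ h)

-- A neighbour of `v` shares exactly one cell with it (`level_corner_eq`), so summing over the cells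
-- at `v` counts it once.
open Classical in
theorem sum_neighborFinset (m : ℕ) (v : (level L d m).V)
    [Fintype ((graph (L + 2) d m).neighborSet (vertexEquiv L d m v))]
    (h : vertices (L + 2) d m → ℝ) :
    ∑ y ∈ (graph (L + 2) d m).neighborFinset (vertexEquiv L d m v), h y =
      ∑ w, ∑ a, if (level L d m).corner w a = v then
        ∑ b ∈ Finset.univ.erase a, h (vertexEquiv L d m ((level L d m).corner w b)) else 0 := by
  let I : Finset ((level L d m).C × (Fin d → Bool) × (Fin d → Bool)) :=
    Finset.univ.filter fun p => (level L d m).corner p.1 p.2.1 = v ∧ p.2.1 ≠ p.2.2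
  have h1 : ∑ y ∈ (graph (L + 2) d m).neighborFinset (vertexEquiv L d m v), h y =
      ∑ p ∈ I, h (vertexEquiv L d m ((level L d m).corner p.1 p.2.2)) := by
    symm
    refine Finset.sum_bij (fun p _ => vertexEquiv L d m ((level L d m).corner p.1 p.2.2))
      ?_ ?_ ?_ (fun _ _ => rfl)
    · rintro ⟨w, a, b⟩ hp
      simp only [I, Finset.mem_filter, Finset.mem_univ, true_and] at hp
      rw [SimpleGraph.mem_neighborFinset, adj_iff]
      exact ⟨w, a, b, hp.2, hp.1, rfl⟩
    · rintro ⟨w, a, b⟩ hp ⟨w', a', b'⟩ hp' he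
      simp only [I, Finset.mem_filter, Finset.mem_univ, true_and] at hp hp'
      have he' := (vertexEquiv L d m).injective he
      obtain ⟨rfl, rfl, rfl⟩ := level_corner_eq L d m hp.2 (hp.1.trans hp'.1.symm) he'
      rfl
    · intro y hy
      obtain ⟨v', rfl⟩ := (vertexEquiv L d m).surjective y
      rw [SimpleGraph.mem_neighborFinset, adj_iff] at hy
      obtain ⟨w, a, b, hab, h1, rfl⟩ := hy
      exact ⟨(w, a, b), by simp [I, h1, hab], rfl⟩
  rw [h1, Finset.sum_filter, Fintype.sum_prod_type]
  refine Finset.sum_congr rfl fun w _ => ?_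
  rw [Fintype.sum_prod_type]
  refine Finset.sum_congr rfl fun a _ => ?_
  split_ifs with h2
  · simp only [h2, true_and]
    rw [← Finset.sum_filter]
    refine Finset.sum_congr ?_ fun _ _ => rfl
    ext b
    simp [ne_comm]
  · simp [h2]

-- The parameter equals `1 + (2^d - 1)(1 - lam)`: the 1 removes the vertex itself from the cell sum,
-- the rest covers its `2^d - 1` neighbours in that cell.
open Classical in
theorem form_single (m : ℕ) (lam : ℝ) (f : vertices (L + 2) d m → ℝ) (v : (level L d m).V) :
    (level L d m).form (2 ^ d - (2 ^ d - 1) * lam) (f ∘ vertexEquiv L d m) (Pi.single v 1) =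
      ∑ y ∈ (graph (L + 2) d m).neighborFinset (vertexEquiv L d m v),
        (f y - (1 - lam) * f (vertexEquiv L d m v)) := by
  rw [sum_neighborFinset, form]
  refine Finset.sum_congr rfl fun w _ => Finset.sum_congr rfl fun a _ => ?_
  split_ifs with h
  · have hc : ((Finset.univ.erase a).card : ℝ) = 2 ^ d - 1 := by
      rw [Finset.card_erase_of_mem (Finset.mem_univ a), Finset.card_univ]
      rw [Nat.cast_sub (Fintype.card_pos)]
      simp
    rw [h, Pi.single_eq_same, cellSum, ← Finset.add_sum_erase _ _ (Finset.mem_univ a),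
      Finset.sum_sub_distrib, Finset.sum_const, nsmul_eq_mul, hc, h]
    simp only [Function.comp]
    ring
  · rw [Pi.single_eq_of_ne h, mul_zero]

theorem neg_laplacian_iff (m : ℕ) (lam : ℝ) (f : vertices (L + 2) d m → ℝ)
    (v : (level L d m).V) :
    -laplacian (L + 2) d m f (vertexEquiv L d m v) = lam * f (vertexEquiv L d m v) ↔
      (open Classical in
      (level L d m).form (2 ^ d - (2 ^ d - 1) * lam) (f ∘ vertexEquiv L d m) (Pi.single v 1)) = 0 := by
  classical
  rw [form_single, laplacian, Finset.sum_sub_distrib, Finset.sum_const, nsmul_eq_mul,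
    SimpleGraph.card_neighborFinset_eq_degree]
  have hdeg : ((graph (L + 2) d m).degree (vertexEquiv L d m v) : ℝ) ≠ 0 := by
    rw [Nat.cast_ne_zero, ← Nat.pos_iff_ne_zero, SimpleGraph.degree_pos_iff_exists_adj]
    obtain ⟨w, a, rfl⟩ := corner_surjective L d m v
    exact ⟨vertexEquiv L d m ((level L d m).corner w (opp a)),
      (adj_iff L d m _ _).mpr ⟨w, a, opp a, (opp_ne a).symm, rfl, rfl⟩⟩
  generalize ((graph (L + 2) d m).degree (vertexEquiv L d m v) : ℝ) = D at *
  constructor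
  · intro h
    field_simp at h
    linear_combination -h
  · intro h
    field_simp
    linear_combination -h

theorem form_eq_sum_single {Q : Type} [Fintype Q] [DecidableEq Q] (X : CellSystem Q)
    [DecidableEq X.V] (s : ℝ) (f g : X.V → ℝ) :
    X.form s f g = ∑ v, g v * X.form s f (Pi.single v 1) := by
  simp only [form, Finset.mul_sum]
  symm
  rw [Finset.sum_comm]
  refine Finset.sum_congr rfl fun w _ => ?_
  rw [Finset.sum_comm]
  refine Finset.sum_congr rfl fun a _ => ?_
  rw [Finset.sum_eq_single (X.corner w a)]
  · simp; ring
  · intro v _ hv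
    rw [Pi.single_eq_of_ne hv.symm]; ring
  · simp

theorem mem_dirichletEigenspace_iff (m : ℕ) (lam : ℝ)
    (f : vertices (L + 2) d m → ℝ) : f ∈ dirichletEigenspace (L + 2) d m lam ↔
      f ∘ vertexEquiv L d m ∈ (level L d m).eigen (2 ^ d - (2 ^ d - 1) * lam) := by
  classical
  constructor
  · rintro ⟨h1, h2⟩
    refine ⟨fun a => h1 _ ((mem_boundary_iff L d m _).mpr ⟨a, rfl⟩), fun g hg => ?_⟩
    rw [form_eq_sum_single]
    refine Finset.sum_eq_zero fun v _ => ?_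
    by_cases hv : ∃ a, (level L d m).bdry a = v
    · obtain ⟨a, rfl⟩ := hv
      rw [hg, zero_mul]
    · rw [(neg_laplacian_iff L d m lam f v).mp (h2 _ fun h => hv ((mem_boundary_iff L d m v).mp h)),
        mul_zero]
  · rintro ⟨h1, h2⟩
    refine ⟨fun x hx => ?_, fun x hx => ?_⟩
    · obtain ⟨v, rfl⟩ := (vertexEquiv L d m).surjective x
      obtain ⟨a, rfl⟩ := (mem_boundary_iff L d m v).mp hx
      exact h1 a
    · obtain ⟨v, rfl⟩ := (vertexEquiv L d m).surjective x
      rw [neg_laplacian_iff L d]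
      refine h2 _ fun a => Pi.single_eq_of_ne (fun h => hx ?_) _
      exact (mem_boundary_iff L d m v).mpr ⟨a, h⟩

theorem finrank_dirichletEigenspace (m : ℕ) (lam : ℝ) :
    finrank ℝ (dirichletEigenspace (L + 2) d m lam) =
      finrank ℝ ((level L d m).eigen (2 ^ d - (2 ^ d - 1) * lam)) := by
  have h : dirichletEigenspace (L + 2) d m lam =
      ((level L d m).eigen (2 ^ d - (2 ^ d - 1) * lam)).comap
        (LinearEquiv.funCongrLeft ℝ ℝ (vertexEquiv L d m)).toLinearMap := by
    ext f
    exact mem_dirichletEigenspace_iff L d m lam f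
  rw [h]
  exact LinearEquiv.finrank_eq (LinearEquiv.ofSubmodule' _ _)

/-! ### Upper bound for the total multiplicity -/

/-- The Dirichlet operator: `-Δ_m` off the boundary and zero on it. -/
def dirichletOperator (n d m : ℕ) : Module.End ℝ (vertices n d m → ℝ) := by
  classical exact
  { toFun := fun f x => if (x : Fin d → ℝ) ∈ vertices n d 0 then 0 else -laplacian n d m f x
    map_add' := fun f g => by
      funext x
      simp only [Pi.add_apply]
      split_ifs
      · simp
      · simp only [laplacian, Pi.add_apply, Finset.sum_add_distrib]
        ring
    map_smul' := fun c f => by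
      funext x
      simp only [Pi.smul_apply, smul_eq_mul, RingHom.id_apply]
      split_ifs
      · simp
      · simp only [laplacian, Pi.smul_apply, smul_eq_mul, ← Finset.mul_sum]
        ring }

/-- The spaces sit inside eigenspaces of a single operator, hence are independent, and their members
vanish at the `2^d` boundary vertices. -/
theorem sum_multiplicity_le (m : ℕ) (F : Finset ℝ) :
    ∑ lam ∈ F, dirichletMultiplicity (L + 2) d m lam + 2 ^ d ≤
      Fintype.card (level L d m).V := by
  classical
  let K : Submodule ℝ (vertices (L + 2) d m → ℝ) :=
    LinearMap.ker (LinearMap.funLeft ℝ ℝ fun a => vertexEquiv L d m ((level L d m).bdry a))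
  have hE : iSupIndep (dirichletEigenspace (L + 2) d m) := by
    refine (Module.End.eigenspaces_iSupIndep (dirichletOperator (L + 2) d m)).mono ?_
    intro lam f hf
    rw [Module.End.mem_eigenspace_iff]
    funext x
    change (if (x : Fin d → ℝ) ∈ vertices (L + 2) d 0 then 0 else _) = lam * f x
    split_ifs with h
    · rw [hf.1 x h, mul_zero]
    · exact hf.2 x h
  have hK : ∀ lam, dirichletEigenspace (L + 2) d m lam ≤ K := by
    intro lam f hf
    rw [LinearMap.mem_ker]
    funext a
    exact hf.1 _ ((mem_boundary_iff L d m _).mpr ⟨a, rfl⟩)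
  have h1 := sum_finrank_le _ hE K hK F
  have h2 := LinearMap.finrank_range_add_finrank_ker
    (LinearMap.funLeft ℝ ℝ fun a => vertexEquiv L d m ((level L d m).bdry a))
  have h3 := LinearMap.funLeft_surjective_of_injective ℝ ℝ
    (fun a => vertexEquiv L d m ((level L d m).bdry a))
    ((vertexEquiv L d m).injective.comp (bdry_injective L d m))
  rw [LinearMap.range_eq_top.mpr h3, finrank_top, Module.finrank_fintype_fun_eq_card,
    Module.finrank_fintype_fun_eq_card, ← Fintype.card_congr (vertexEquiv L d m)] at h2
  have h4 : Fintype.card (Fin d → Bool) = 2 ^ d := by simp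
  change ∑ lam ∈ F, finrank ℝ _ + _ ≤ _
  rw [h4] at h2
  change _ + finrank ℝ K = _ at h2
  omega

end Geometry

/-! ### The decimation polynomial: factorisation and trigonometric form -/

section Decimation

variable (L d : ℕ)

/-- The value `t = 1 - (2 ^ d - 1) λ`. -/
def tVal (x : ℝ) : ℝ := 1 - ((2 : ℝ) ^ d - 1) * x

theorem eval_tPoly (x : ℝ) : (tPoly d).eval x = tVal d x := by simp [tPoly, tVal]

theorem eval_chebU (j : ℤ) (x : ℝ) : (chebU d j).eval x = cU (tVal d x) j := by
  simp [chebU, eval_comp, eval_tPoly, cU]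

theorem eval_chebT (j : ℤ) (x : ℝ) :
    (chebT d j).eval x = (Chebyshev.T ℝ j).eval (tVal d x) := by
  simp [chebT, eval_comp, eval_tPoly]

theorem eval_A (x : ℝ) :
    (A (L + 2) d).eval x = cU (tVal d x) (L + 1) + cU (tVal d x) L := by
  rw [A, eval_add, eval_chebU, eval_chebU]
  push_cast
  rw [show (L : ℤ) + 2 - 1 = L + 1 by ring, show (L : ℤ) + 2 - 2 = L by ring]

theorem eval_S_eq_T (x : ℝ) : (S (L + 2) d).eval x =
    (Chebyshev.T ℝ (L + 2)).eval (tVal d x) +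
      ((2 : ℝ) ^ d - 1) * (Chebyshev.T ℝ (L + 1)).eval (tVal d x) := by
  simp only [S, eval_add, eval_mul, eval_C, eval_chebT]
  push_cast
  rw [show (L : ℤ) + 2 - 1 = L + 1 by ring]

theorem eval_S (x : ℝ) : (S (L + 2) d).eval x = sVal L (2 ^ d) (tVal d x) := by
  rw [eval_S_eq_T, sVal, Chebyshev.T_eq_X_mul_U_sub_U, Chebyshev.T_eq_U_sub_X_mul_U]
  simp [cU]

/-- The factor of `top d - R n d` complementary to `S n d`, up to a scalar. -/
def cofactor : ℝ[X] := chebU d (L + 1) - chebU d L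

theorem eval_cofactor (x : ℝ) :
    (cofactor L d).eval x = cU (tVal d x) (L + 1) - cU (tVal d x) L := by
  rw [cofactor, eval_sub, eval_chebU, eval_chebU]

/-- Identifies the parameter `s'` of the extension step: it is the one belonging to the eigenvalue
`R(x)`. -/
theorem eval_R_rel (x : ℝ) : 2 ^ d - (2 ^ d - 1) * (R (L + 2) d).eval x =
    (S (L + 2) d).eval x * (cofactor L d).eval x := by
  have h := cU_rel L (tVal d x)
  rw [eval_S, eval_cofactor, sVal]
  simp only [R, eval_add, eval_sub, eval_mul, eval_pow, eval_one, eval_X, eval_tPoly, eval_chebU]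
  push_cast
  rw [show (L : ℤ) + 2 - 1 = L + 1 by ring, show (L : ℤ) + 2 - 2 = L by ring]
  have ht : ((2 : ℝ) ^ d - 1) * x = 1 - tVal d x := by rw [tVal]; ring
  linear_combination -h + (-(cU (tVal d x) (L + 1)) ^ 2 -
    cU (tVal d x) (L + 1) * cU (tVal d x) L) * ht

/-- At `t = cos 2h` the half angle gives `U_{n-1} + U_{n-2} = sin((2n-1)h) / sin h`, and below
`U_{n-1} - U_{n-2} = cos((2n-1)h) / cos h`, from which the roots can be read off. -/
theorem cU_add_mul_sin {h : ℝ} (hc : Real.cos h ≠ 0) :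
    (cU (Real.cos (2 * h)) (L + 1) + cU (Real.cos (2 * h)) L) * Real.sin h =
      Real.sin ((2 * L + 3) * h) := by
  have h1 := Chebyshev.U_real_cos (2 * h) (L + 1)
  have h2 := Chebyshev.U_real_cos (2 * h) L
  push_cast at h1 h2
  rw [show ((L : ℝ) + 1 + 1) * (2 * h) = (2 * L + 3) * h + h by ring, Real.sin_add,
    Real.sin_two_mul] at h1
  rw [show ((L : ℝ) + 1) * (2 * h) = (2 * L + 3) * h - h by ring, Real.sin_sub,
    Real.sin_two_mul] at h2
  simp only [cU]
  refine mul_right_cancel₀ (mul_ne_zero two_ne_zero hc) ?_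
  linear_combination h1 + h2

theorem cU_sub_mul_cos {h : ℝ} (hs : Real.sin h ≠ 0) :
    (cU (Real.cos (2 * h)) (L + 1) - cU (Real.cos (2 * h)) L) * Real.cos h =
      Real.cos ((2 * L + 3) * h) := by
  have h1 := Chebyshev.U_real_cos (2 * h) (L + 1)
  have h2 := Chebyshev.U_real_cos (2 * h) L
  push_cast at h1 h2
  rw [show ((L : ℝ) + 1 + 1) * (2 * h) = (2 * L + 3) * h + h by ring, Real.sin_add,
    Real.sin_two_mul] at h1
  rw [show ((L : ℝ) + 1) * (2 * h) = (2 * L + 3) * h - h by ring, Real.sin_sub,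
    Real.sin_two_mul] at h2
  simp only [cU]
  refine mul_right_cancel₀ (mul_ne_zero two_ne_zero hs) ?_
  linear_combination h1 - h2

theorem eval_S_trig {x h : ℝ} (hx : tVal d x = Real.cos (2 * h)) : (S (L + 2) d).eval x =
    2 ^ d * Real.cos ((2 * L + 3) * h) * Real.cos h +
      (2 ^ d - 2) * Real.sin ((2 * L + 3) * h) * Real.sin h := by
  rw [eval_S_eq_T, hx, Chebyshev.T_real_cos, Chebyshev.T_real_cos]
  push_cast
  rw [show ((L : ℝ) + 2) * (2 * h) = (2 * L + 3) * h + h by ring,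
    show ((L : ℝ) + 1) * (2 * h) = (2 * L + 3) * h - h by ring, Real.cos_add, Real.cos_sub]
  ring

theorem eval_R_trig {x h : ℝ} (hx : tVal d x = Real.cos (2 * h)) (hs : Real.sin h ≠ 0) :
    2 * Real.cos h * (2 ^ d - (2 ^ d - 1) * (R (L + 2) d).eval x) =
      2 ^ d * Real.cos h + 2 ^ d * Real.cos h * Real.cos (2 * ((2 * L + 3) * h)) +
        (2 ^ d - 2) * Real.sin h * Real.sin (2 * ((2 * L + 3) * h)) := by
  rw [eval_R_rel, eval_S_trig L d hx, eval_cofactor, hx, Real.cos_two_mul ((2 * L + 3) * h),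
    Real.sin_two_mul ((2 * L + 3) * h)]
  have h1 := cU_sub_mul_cos L hs
  linear_combination 2 * (2 ^ d * Real.cos ((2 * L + 3) * h) * Real.cos h +
      (2 ^ d - 2) * Real.sin ((2 * L + 3) * h) * Real.sin h) * h1

theorem four_le_two_pow (hd : 2 ≤ d) : (4 : ℝ) ≤ 2 ^ d := by
  have : (2 : ℝ) ^ 2 ≤ 2 ^ d := pow_le_pow_right₀ (by norm_num) hd
  linarith

theorem tVal_div (hd : 2 ≤ d) (t : ℝ) : tVal d ((1 - t) / (2 ^ d - 1)) = t := by
  have := four_le_two_pow d hd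
  have h : (2 : ℝ) ^ d - 1 ≠ 0 := by linarith
  rw [tVal]
  field_simp
  ring

theorem tVal_top (hd : 2 ≤ d) : tVal d (top d) = 1 - 2 ^ d := by
  have := four_le_two_pow d hd
  have h : (2 : ℝ) ^ d - 1 ≠ 0 := by linarith
  rw [tVal, top]
  field_simp

theorem top_pos (hd : 2 ≤ d) : 0 < top d := by
  have := four_le_two_pow d hd
  rw [top]
  apply div_pos <;> linarith

theorem top_mul (hd : 2 ≤ d) : (2 ^ d - 1) * top d = 2 ^ d := by
  have := tVal_top d hd
  rw [tVal] at this
  linarith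

/-- Needed at `top d`, where `t = 1 - 2^d` lies to the left of the interval covered by `t = cos 2h`.
-/
theorem cU_alternating {y : ℝ} (hy : y ≤ -1) (j : ℕ) :
    0 < (-1) ^ j * cU y j ∧ (-1) ^ j * cU y j ≤ (-1) ^ (j + 1) * cU y (j + 1) := by
  induction j with
  | zero =>
    have h := cU_add_two y (-1)
    norm_num at h
    simp [h]
    linarith
  | succ j ih =>
    have h := cU_add_two y j
    push_cast
    rw [show (j : ℤ) + 1 + 1 = j + 2 by ring, h]
    refine ⟨by linarith, ?_⟩
    have h1 := mul_nonneg (sub_nonneg.mpr hy) (ih.1.le.trans ih.2)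
    simp only [pow_succ] at *
    linarith

theorem eval_S_top_sign (hd : 2 ≤ d) : 0 < (-1) ^ L * (S (L + 2) d).eval (top d) := by
  have hP := four_le_two_pow d hd
  have h := (cU_alternating (y := 1 - 2 ^ d) (by linarith) L).1
  rw [eval_S, tVal_top d hd, sVal]
  have : (-1) ^ L * ((1 - (2 : ℝ) ^ d) * cU (1 - 2 ^ d) (L + 1) - cU (1 - 2 ^ d) L +
    (2 ^ d - 1) * (cU (1 - 2 ^ d) (L + 1) - (1 - 2 ^ d) * cU (1 - 2 ^ d) L)) =
      (2 ^ d * (2 ^ d - 2)) * ((-1) ^ L * cU (1 - 2 ^ d) L) := by ring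
  rw [this]
  exact mul_pos (mul_pos (by linarith) (by linarith)) h

/-- At this point the two factors of `eval_R_rel` have opposite signs. -/
theorem top_lt_eval_R_top (hd : 2 ≤ d) : top d < (R (L + 2) d).eval (top d) := by
  have hP := four_le_two_pow d hd
  have h := cU_alternating (y := 1 - 2 ^ d) (by linarith) L
  have h1 := eval_S_top_sign L d hd
  have h2 := eval_R_rel L d (top d)
  rw [eval_cofactor, tVal_top d hd] at h2
  have h3 : (-1 : ℝ) ^ L * (-1) ^ L = 1 := by rw [← mul_pow]; norm_num
  have h4 : (-1) ^ L * (cU (1 - 2 ^ d) (L + 1) - cU (1 - 2 ^ d) L) < 0 := by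
    rw [pow_succ] at h
    linarith
  have h5 := mul_neg_of_pos_of_neg h1 h4
  have h6 := top_mul d hd
  have h7 : (S (L + 2) d).eval (top d) * (cU (1 - 2 ^ d) (L + 1) - cU (1 - 2 ^ d) L) < 0 := by
    have : (-1) ^ L * (S (L + 2) d).eval (top d) *
      ((-1) ^ L * (cU (1 - 2 ^ d) (L + 1) - cU (1 - 2 ^ d) L)) =
        ((-1) ^ L * (-1) ^ L) * ((S (L + 2) d).eval (top d) *
        (cU (1 - 2 ^ d) (L + 1) - cU (1 - 2 ^ d) L)) := by ring
    rw [this, h3, one_mul] at h5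
    exact h5
  nlinarith

/-! ### Location of the inverse branches -/

/-- The points separating the inverse branches of `R`. -/
def node (k : ℕ) : ℝ :=
  if k ≤ 2 * L + 2 then (1 - Real.cos (2 * (k * Real.pi / (4 * L + 5)))) / (2 ^ d - 1) else top d

theorem angle_bounds {a b : ℝ} (ha : 0 < a) (hab : 2 * a < b) :
    0 < a * Real.pi / b ∧ a * Real.pi / b < Real.pi / 2 := by
  have hb : 0 < b := by linarith
  have := Real.pi_pos
  refine ⟨by positivity, ?_⟩
  rw [div_lt_div_iff₀ hb two_pos]
  nlinarith

theorem point_lt_point (hd : 2 ≤ d) {a b : ℝ} (ha : 0 ≤ a) (hab : a < b) (hb : b < Real.pi / 2) :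
    (1 - Real.cos (2 * a)) / ((2 : ℝ) ^ d - 1) < (1 - Real.cos (2 * b)) / (2 ^ d - 1) := by
  have hP := four_le_two_pow d hd
  refine div_lt_div_of_pos_right ?_ (by linarith)
  have := Real.cos_lt_cos_of_nonneg_of_le_pi (x := 2 * a) (y := 2 * b) (by linarith) (by linarith)
    (by linarith)
  linarith

theorem point_lt_top (hd : 2 ≤ d) (a : ℝ) :
    (1 - Real.cos a) / ((2 : ℝ) ^ d - 1) < top d := by
  have hP := four_le_two_pow d hd
  rw [top]
  refine div_lt_div_of_pos_right ?_ (by linarith)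
  have := Real.neg_one_le_cos a
  linarith

theorem node_zero : node L d 0 = 0 := by simp [node]

theorem node_last : node L d (2 * L + 3) = top d := by simp [node]

theorem node_lt_succ (hd : 2 ≤ d) {k : ℕ} (hk : k < 2 * L + 3) : node L d k < node L d (k + 1) := by
  rw [node, node, if_pos (by omega)]
  split_ifs with h
  · have h1 : ((k + 1 : ℕ) : ℝ) ≤ 2 * L + 2 := by exact_mod_cast h
    have h2 := (angle_bounds (a := ((k + 1 : ℕ) : ℝ)) (b := 4 * L + 5) (by positivity)
      (by linarith)).2
    refine point_lt_point d hd (by positivity) ?_ h2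
    have := Real.pi_pos
    push_cast
    gcongr
    linarith
  · exact point_lt_top d hd _

theorem node_mono (hd : 2 ≤ d) {j k : ℕ} (hjk : j ≤ k) (hk : k ≤ 2 * L + 3) :
    node L d j ≤ node L d k := by
  induction k, hjk using Nat.le_induction with
  | base => exact le_rfl
  | succ k hjk ih => exact (ih (by omega)).trans (node_lt_succ L d hd (by omega)).le

theorem eval_R_zero (hd : 2 ≤ d) : (R (L + 2) d).eval 0 = 0 := by
  have hP := four_le_two_pow d hd
  have h := eval_R_rel L d 0
  rw [eval_S, eval_cofactor, sVal] at h
  have ht : tVal d 0 = 1 := by simp [tVal]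
  rw [ht] at h
  have h1 : ∀ j : ℤ, cU 1 j = j + 1 := fun j => by simp [cU, Chebyshev.U_eval_one]
  simp only [h1] at h
  push_cast at h
  have h2 : ((2 : ℝ) ^ d - 1) * (R (L + 2) d).eval 0 = 0 := by linear_combination -h
  rcases mul_eq_zero.mp h2 with h3 | h3
  · linarith
  · exact h3

/-- The nodes are chosen so that `2(2L+3)h = h + kπ`. Then `eval_R_trig` collapses: `-(1 - cos
h)(2^d - 2 - 2 cos h)` equals `2 (2^d - 1) cos h` times `R` for even `k`, and times `top - R` for
odd `k`. The second factor is positive because `2^d ≥ 4`. -/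
theorem eval_R_node (hd : 2 ≤ d) {k : ℕ} (hk0 : 0 < k) (hk : k ≤ 2 * L + 2) :
    (Even k → (R (L + 2) d).eval (node L d k) < 0) ∧
      (Odd k → top d < (R (L + 2) d).eval (node L d k)) := by
  have hP := four_le_two_pow d hd
  set h := (k : ℝ) * Real.pi / (4 * L + 5) with hh
  have h1 : (k : ℝ) ≤ 2 * L + 2 := by exact_mod_cast hk
  have hb := angle_bounds (a := (k : ℝ)) (b := 4 * L + 5) (by exact_mod_cast hk0) (by linarith)
  have hnode : tVal d (node L d k) = Real.cos (2 * h) := by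
    rw [node, if_pos hk, tVal_div d hd]
  have hcos : 0 < Real.cos h := Real.cos_pos_of_mem_Ioo ⟨by linarith [hb.1], hb.2⟩
  have hsin : 0 < Real.sin h := Real.sin_pos_of_pos_of_lt_pi hb.1 (by linarith [Real.pi_pos, hb.2])
  have hrel := eval_R_trig L d hnode hsin.ne'
  have hang : 2 * ((2 * L + 3) * h) = h + k * Real.pi := by
    rw [hh]; field_simp; ring
  rw [hang, Real.cos_add_nat_mul_pi, Real.sin_add_nat_mul_pi] at hrel
  have hsq := Real.sin_sq_add_cos_sq h
  have hc1 : Real.cos h < 1 := by nlinarith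
  have hkey : 0 < (1 - Real.cos h) * (2 ^ d - 2 - 2 * Real.cos h) :=
    mul_pos (by linarith) (by linarith)
  have htop := top_mul d hd
  refine ⟨fun he => ?_, fun ho => ?_⟩
  · rw [he.neg_one_pow] at hrel
    have : 2 * Real.cos h * ((2 ^ d - 1) * (R (L + 2) d).eval (node L d k)) < 0 := by
      nlinarith
    by_contra hcon
    push Not at hcon
    have : 0 ≤ 2 * Real.cos h * ((2 ^ d - 1) * (R (L + 2) d).eval (node L d k)) := by
      have : (0 : ℝ) ≤ 2 ^ d - 1 := by linarith
      positivity
    linarith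
  · rw [ho.neg_one_pow] at hrel
    have : 2 * Real.cos h * ((2 ^ d - 1) * (top d - (R (L + 2) d).eval (node L d k))) < 0 := by
      nlinarith
    by_contra hcon
    push Not at hcon
    have : 0 ≤ 2 * Real.cos h * ((2 ^ d - 1) * (top d - (R (L + 2) d).eval (node L d k))) := by
      have h2 : (0 : ℝ) ≤ 2 ^ d - 1 := by linarith
      have h3 : 0 ≤ top d - (R (L + 2) d).eval (node L d k) := by linarith
      positivity
    linarith

/-- At successive nodes `R` lies on opposite sides of `[0, top]`, so the intermediate value theorem
applies. The left end stays in since `R(0) = 0` at the first node; at every right end `R` is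
strictly outside. -/
theorem exists_preimage (hd : 2 ≤ d) {x : ℝ} (hx : x ∈ Set.Icc 0 (top d)) {k : ℕ}
    (hk : k < 2 * L + 3) :
    ∃ y ∈ Set.Ico (node L d k) (node L d (k + 1)), (R (L + 2) d).eval y = x := by
  have hcont : ContinuousOn (fun y => (R (L + 2) d).eval y)
      (Set.Icc (node L d k) (node L d (k + 1))) := (Polynomial.continuous _).continuousOn
  have hle := (node_lt_succ L d hd hk).le
  have hodd : ∀ j, Odd j → j ≤ 2 * L + 3 → top d < (R (L + 2) d).eval (node L d j) := by
    intro j hj hj'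
    rcases eq_or_lt_of_le hj' with h | h
    · rw [h, node_last]
      exact top_lt_eval_R_top L d hd
    · exact (eval_R_node L d hd hj.pos (by omega)).2 hj
  have heven : ∀ j, Even j → j ≤ 2 * L + 2 → (R (L + 2) d).eval (node L d j) ≤ 0 := by
    intro j hj hj'
    rcases Nat.eq_zero_or_pos j with h | h
    · rw [h, node_zero, eval_R_zero L d hd]
    · exact ((eval_R_node L d hd h hj').1 hj).le
  have hmem : ∃ y ∈ Set.Icc (node L d k) (node L d (k + 1)), (R (L + 2) d).eval y = x := by
    rcases Nat.even_or_odd k with he | ho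
    · exact intermediate_value_Icc hle hcont ⟨(heven k he (by omega)).trans hx.1,
        hx.2.trans (hodd (k + 1) he.add_one (by omega)).le⟩
    · have : k + 1 ≤ 2 * L + 2 := by
        rcases eq_or_lt_of_le (Nat.succ_le_of_lt hk) with h | h
        · exfalso
          obtain ⟨c, hc⟩ := ho
          omega
        · omega
      exact intermediate_value_Icc' hle hcont ⟨(heven (k + 1) ho.add_one this).trans hx.1,
        hx.2.trans (hodd k ho (by omega)).le⟩
  obtain ⟨y, hy, hyx⟩ := hmem
  refine ⟨y, ⟨hy.1, lt_of_le_of_ne hy.2 fun h => ?_⟩, hyx⟩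
  subst h
  rcases Nat.even_or_odd (k + 1) with he | ho
  · have : k + 1 ≤ 2 * L + 2 := by
      obtain ⟨c, hc⟩ := he
      omega
    have := (eval_R_node L d hd (Nat.succ_pos k) this).1 he
    linarith [hx.1]
  · have := hodd _ ho hk
    linarith [hx.2]

theorem roots_toFinset_eq_image {p : ℝ[X]} (hp : p ≠ 0) {N : ℕ} (hN : p.natDegree ≤ N)
    {r : Fin N → ℝ} (hr : Function.Injective r) (hroot : ∀ i, p.eval (r i) = 0) :
    p.roots.toFinset = Finset.univ.image r := by
  symm
  refine Finset.eq_of_subset_of_card_le ?_ ?_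
  · intro y hy
    obtain ⟨i, -, rfl⟩ := Finset.mem_image.mp hy
    rw [Multiset.mem_toFinset, mem_roots hp]
    exact hroot i
  · rw [Finset.card_image_of_injective _ hr, Finset.card_univ, Fintype.card_fin]
    exact (Multiset.toFinset_card_le _).trans ((card_roots' p).trans hN)

theorem root_iff {p : ℝ[X]} (hp : p ≠ 0) {N : ℕ} (hN : p.natDegree ≤ N)
    {r : Fin N → ℝ} (hr : Function.Injective r) (hroot : ∀ i, p.eval (r i) = 0) (y : ℝ) :
    p.eval y = 0 ↔ ∃ i, r i = y := by
  have h := roots_toFinset_eq_image hp hN hr hroot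
  have h1 : y ∈ p.roots.toFinset ↔ p.eval y = 0 := by
    rw [Multiset.mem_toFinset, mem_roots hp]; rfl
  rw [← h1, h]
  simp

theorem ncard_roots {p : ℝ[X]} (hp : p ≠ 0) {N : ℕ} (hN : p.natDegree ≤ N)
    {r : Fin N → ℝ} (hr : Function.Injective r) (hroot : ∀ i, p.eval (r i) = 0) :
    {y : ℝ | p.eval y = 0}.ncard = N := by
  have : {y : ℝ | p.eval y = 0} = Set.range r := by
    ext y
    exact root_iff hp hN hr hroot y
  rw [this, ← Set.image_univ, Set.ncard_image_of_injective _ hr, Set.ncard_univ, Nat.card_fin]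

theorem sort_getD {s : Finset ℝ} {N : ℕ} {r : Fin N → ℝ} (hr : StrictMono r)
    (hs : s = Finset.univ.image r) (i : Fin N) : (s.sort (· ≤ ·)).getD i 0 = r i := by
  have hcard : s.card = N := by
    rw [hs, Finset.card_image_of_injective _ hr.injective, Finset.card_univ, Fintype.card_fin]
  have h := Finset.orderEmbOfFin_unique hcard (f := r) (fun i => by rw [hs]; simp) hr
  rw [h, Finset.orderEmbOfFin_apply, List.getD_eq_getElem]
  · rfl

theorem strictMono_of_mem_Ico {N : ℕ} {ν : ℕ → ℝ} (hν : ∀ j k, j ≤ k → k ≤ N → ν j ≤ ν k)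
    {r : Fin N → ℝ} (hr : ∀ k : Fin N, r k ∈ Set.Ico (ν k) (ν (k + 1))) : StrictMono r := by
  intro j k hjk
  have h1 := hν (j + 1) k (by exact hjk) (by omega)
  exact (hr j).2.trans_le (h1.trans (hr k).1)

theorem natDegree_sub_le_of_degree_le {p q : ℝ[X]} {n : ℕ} (hp : p.natDegree ≤ n)
    (hq : q.natDegree ≤ n) : (p - q).natDegree ≤ n :=
  (natDegree_sub_le_of_le hp hq).trans (max_self n).le

theorem natDegree_tPoly_le : (tPoly d).natDegree ≤ 1 := by
  rw [tPoly]
  compute_degree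

theorem natDegree_chebU_le (j : ℕ) : (chebU d j).natDegree ≤ j := by
  refine natDegree_comp_le.trans ?_
  rw [Chebyshev.natDegree_U_natCast]
  exact (Nat.mul_le_mul_left j (natDegree_tPoly_le d)).trans (by simp)

theorem natDegree_chebT_le (j : ℕ) : (chebT d j).natDegree ≤ j := by
  refine natDegree_comp_le.trans ?_
  have : (Chebyshev.T ℝ j).natDegree ≤ j := by
    simp
  exact (Nat.mul_le_mul this (natDegree_tPoly_le d)).trans (by simp)

theorem natDegree_chebU_succ_le : (chebU d (L + 1)).natDegree ≤ L + 1 := by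
  have := natDegree_chebU_le d (L + 1)
  push_cast at this
  exact this

theorem natDegree_cofactor_le : (cofactor L d).natDegree ≤ L + 1 :=
  natDegree_sub_le_of_degree_le (natDegree_chebU_succ_le L d)
    ((natDegree_chebU_le d L).trans (Nat.le_succ L))

theorem natDegree_A_le : (A (L + 2) d).natDegree ≤ L + 1 := by
  rw [A]
  push_cast
  rw [show (L : ℤ) + 2 - 1 = L + 1 by ring, show (L : ℤ) + 2 - 2 = L by ring]
  exact natDegree_add_le_of_degree_le (natDegree_chebU_succ_le L d)
    ((natDegree_chebU_le d L).trans (Nat.le_succ L))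

theorem natDegree_S_le : (S (L + 2) d).natDegree ≤ L + 2 := by
  rw [S]
  have h1 := natDegree_chebT_le d (L + 2)
  have h2 := natDegree_chebT_le d (L + 1)
  push_cast at *
  rw [show (L : ℤ) + 2 - 1 = L + 1 by ring]
  exact natDegree_add_le_of_degree_le h1
    ((natDegree_C_mul_le _ _).trans (h2.trans (Nat.le_succ _)))

theorem natDegree_R_sub_le (x : ℝ) : (R (L + 2) d - C x).natDegree ≤ 2 * L + 3 := by
  rw [R]
  push_cast
  rw [show (L : ℤ) + 2 - 1 = L + 1 by ring, show (L : ℤ) + 2 - 2 = L by ring]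
  have h1 := natDegree_chebU_succ_le L d
  have h2 := natDegree_chebU_le d L
  have h3 := natDegree_tPoly_le d
  have h4 : (X - 1 : ℝ[X]).natDegree ≤ 1 := by compute_degree
  have h5 : (tPoly d + X + 1).natDegree ≤ 1 :=
    natDegree_add_le_of_degree_le (natDegree_add_le_of_degree_le h3 natDegree_X_le) (by simp)
  refine natDegree_sub_le_of_degree_le (natDegree_sub_le_of_degree_le (natDegree_add_le_of_degree_le
    (natDegree_add_le_of_degree_le (by simp) ?_) ?_) ?_) (by simp)
  · exact (natDegree_mul_le_of_le h4 (natDegree_pow_le_of_le 2 h1)).trans (by omega)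
  · exact (natDegree_mul_le_of_le (natDegree_mul_le_of_le h5 h1) h2).trans (by omega)
  · exact (natDegree_mul_le_of_le h3 (natDegree_pow_le_of_le 2 h2)).trans (by omega)

theorem R_sub_ne_zero (hd : 2 ≤ d) (x : ℝ) : R (L + 2) d - C x ≠ 0 := by
  intro h
  have h1 : ∀ y, (R (L + 2) d).eval y = x := fun y => by
    have := congrArg (eval y) h
    simpa [sub_eq_zero] using this
  have h2 := top_lt_eval_R_top L d hd
  have h3 := eval_R_zero L d hd
  rw [h1] at h2 h3
  linarith [top_pos d hd]

/-- One solution in each of the `2L + 3` intervals exhausts the degree, so the index of a branch is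
the index of the interval containing it. -/
theorem branch_structure (hd : 2 ≤ d) {x : ℝ} (hx : x ∈ Set.Icc 0 (top d)) :
    ∃ r : Fin (2 * L + 3) → ℝ, StrictMono r ∧
      (∀ k : Fin (2 * L + 3), r k ∈ Set.Ico (node L d k) (node L d (k + 1))) ∧
      (∀ k : Fin (2 * L + 3), branch (L + 2) d k x = r k) ∧ ∀ y, (R (L + 2) d).eval y = x ↔ ∃ k, r k = y := by
  choose r hr hrx using fun k : Fin (2 * L + 3) => exists_preimage L d hd hx k.2
  have hmono : StrictMono r :=
    strictMono_of_mem_Ico (fun j k hjk hk => node_mono L d hd hjk hk) hr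
  have hroot : ∀ k, (R (L + 2) d - C x).eval (r k) = 0 := fun k => by
    rw [eval_sub, eval_C, hrx, sub_self]
  have hp := R_sub_ne_zero L d hd x
  have hN := natDegree_R_sub_le L d x
  refine ⟨r, hmono, hr, fun k => ?_, fun y => ?_⟩
  · exact sort_getD hmono
      (by rw [← roots_toFinset_eq_image hp hN hmono.injective hroot]) k
  · rw [← root_iff hp hN hmono.injective hroot, eval_sub, eval_C, sub_eq_zero]

theorem eval_R_branch (hd : 2 ≤ d) {x : ℝ} (hx : x ∈ Set.Icc 0 (top d)) {l : ℕ}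
    (hl : l < 2 * L + 3) : (R (L + 2) d).eval (branch (L + 2) d l x) = x := by
  obtain ⟨r, -, -, h2, h3⟩ := branch_structure L d hd hx
  exact (h3 _).mpr ⟨⟨l, hl⟩, (h2 ⟨l, hl⟩).symm⟩

theorem exists_branch_eq (hd : 2 ≤ d) {x y : ℝ} (hx : x ∈ Set.Icc 0 (top d))
    (h : (R (L + 2) d).eval y = x) : ∃ l < 2 * L + 3, branch (L + 2) d l x = y := by
  obtain ⟨r, -, -, h2, h3⟩ := branch_structure L d hd hx
  obtain ⟨k, hk⟩ := (h3 y).mp h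
  exact ⟨k, k.2, (h2 k).trans hk⟩

theorem branch_eq_of_mem_Ico (hd : 2 ≤ d) {x y : ℝ} (hx : x ∈ Set.Icc 0 (top d))
    (h : (R (L + 2) d).eval y = x) {l : ℕ} (hl : l < 2 * L + 3)
    (hy : y ∈ Set.Ico (node L d l) (node L d (l + 1))) : branch (L + 2) d l x = y := by
  obtain ⟨r, -, h1, h2, h3⟩ := branch_structure L d hd hx
  obtain ⟨k, rfl⟩ := (h3 y).mp h
  have h4 := h1 k
  have h5 : (k : ℕ) = l := by
    by_contra hne
    rcases lt_or_gt_of_ne hne with hlt | hlt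
    · have := node_mono L d hd (Nat.succ_le_of_lt hlt) hl.le
      exact absurd (h4.2.trans_le this) (not_lt.mpr hy.1)
    · have := node_mono L d hd (Nat.succ_le_of_lt hlt) k.2.le
      exact absurd (hy.2.trans_le this) (not_lt.mpr h4.1)
  rw [← h5]
  exact h2 k

theorem branch_injective (hd : 2 ≤ d) {x : ℝ} (hx : x ∈ Set.Icc 0 (top d)) {l l' : ℕ}
    (hl : l < 2 * L + 3) (hl' : l' < 2 * L + 3)
    (h : branch (L + 2) d l x = branch (L + 2) d l' x) : l = l' := by
  obtain ⟨r, h0, h1, h2, h3⟩ := branch_structure L d hd hx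
  have := h0.injective ((h2 ⟨l, hl⟩).symm.trans (h.trans (h2 ⟨l', hl'⟩)))
  exact congrArg Fin.val this

theorem mem_Ico_of_eval_R (hd : 2 ≤ d) {x y : ℝ} (hx : x ∈ Set.Icc 0 (top d))
    (h : (R (L + 2) d).eval y = x) : y ∈ Set.Ico 0 (top d) := by
  obtain ⟨r, -, h1, h2, h3⟩ := branch_structure L d hd hx
  obtain ⟨k, rfl⟩ := (h3 y).mp h
  have h4 := node_mono L d hd (Nat.zero_le k) k.2.le
  have h5 := node_mono L d hd (Nat.succ_le_of_lt k.2) le_rfl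
  rw [node_zero] at h4
  rw [node_last] at h5
  exact ⟨h4.trans (h1 k).1, (h1 k).2.trans_le h5⟩

theorem ncard_preimage (hd : 2 ≤ d) {x : ℝ} (hx : x ∈ Set.Icc 0 (top d)) :
    {y : ℝ | (R (L + 2) d).eval y = x}.ncard = 2 * L + 3 := by
  obtain ⟨r, h0, h1, h2, h3⟩ := branch_structure L d hd hx
  have : {y : ℝ | (R (L + 2) d).eval y = x} = Set.range r := by
    ext y
    exact h3 y
  rw [this, ← Set.image_univ, Set.ncard_image_of_injective _ h0.injective, Set.ncard_univ,
    Nat.card_fin]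

/-! ### The fibres over `top` and over 0 -/

theorem eval_R_of_S (hd : 2 ≤ d) {y : ℝ} (h : (S (L + 2) d).eval y = 0) :
    (R (L + 2) d).eval y = top d := by
  have hP := four_le_two_pow d hd
  have h1 := eval_R_rel L d y
  have h2 := top_mul d hd
  rw [h, zero_mul] at h1
  have : ((2 : ℝ) ^ d - 1) ≠ 0 := by linarith
  exact mul_left_cancel₀ this (by linarith)

theorem eval_R_of_cofactor (hd : 2 ≤ d) {y : ℝ} (h : (cofactor L d).eval y = 0) :
    (R (L + 2) d).eval y = top d := by
  have hP := four_le_two_pow d hd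
  have h1 := eval_R_rel L d y
  have h2 := top_mul d hd
  rw [h, mul_zero] at h1
  have : ((2 : ℝ) ^ d - 1) ≠ 0 := by linarith
  exact mul_left_cancel₀ this (by linarith)

theorem eval_R_eq_top_iff (hd : 2 ≤ d) {y : ℝ} : (R (L + 2) d).eval y = top d ↔
    (S (L + 2) d).eval y = 0 ∨ (cofactor L d).eval y = 0 := by
  refine ⟨fun h => ?_, fun h => h.elim (eval_R_of_S L d hd) (eval_R_of_cofactor L d hd)⟩
  have h1 := eval_R_rel L d y
  rw [h, top_mul d hd, sub_self] at h1
  exact mul_eq_zero.mp h1.symm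

/-- If `U_{n-1} = U_{n-2} = v`, then `S = (2^d - 2)(1 - t) v`, while `cU_rel` reads `2 (1 - t) v² =
1`. So the two kinds of points over `top` are disjoint. -/
theorem eval_S_ne_zero_of_cofactor (hd : 2 ≤ d) {y : ℝ} (h : (cofactor L d).eval y = 0) :
    (S (L + 2) d).eval y ≠ 0 := by
  intro hS
  have hP := four_le_two_pow d hd
  have h1 := cU_rel L (tVal d y)
  rw [eval_cofactor] at h
  rw [eval_S, sVal] at hS
  have h2 : cU (tVal d y) (L + 1) = cU (tVal d y) L := by linarith
  rw [h2] at h1 hS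
  have h3 : (2 ^ d - 2) * ((1 - tVal d y) * cU (tVal d y) L) = 0 := by linear_combination hS
  rcases mul_eq_zero.mp h3 with h4 | h4
  · linarith
  · have : 2 * cU (tVal d y) L * ((1 - tVal d y) * cU (tVal d y) L) = 1 := by
      linear_combination h1
    rw [h4, mul_zero] at this
    exact zero_ne_one this

theorem eval_R_of_A (hd : 2 ≤ d) {y : ℝ} (h : (A (L + 2) d).eval y = 0) :
    (R (L + 2) d).eval y = 0 := by
  have hP := four_le_two_pow d hd
  have h1 := eval_R_rel L d y
  have h2 := cU_rel L (tVal d y)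
  rw [eval_A] at h
  have h3 : cU (tVal d y) (L + 1) = -cU (tVal d y) L := by linarith
  rw [eval_S, sVal, eval_cofactor] at h1
  rw [h3] at h1 h2
  have : ((2 : ℝ) ^ d - 1) * (R (L + 2) d).eval y = 0 := by
    linear_combination -h1 - 2 ^ d * h2
  rcases mul_eq_zero.mp this with h4 | h4
  · linarith
  · exact h4

theorem sin_ne_zero_and_cos_ne_zero {a b : ℝ} (ha : 0 < a) (hab : 2 * a < b) :
    Real.sin (a * Real.pi / b) ≠ 0 ∧ Real.cos (a * Real.pi / b) ≠ 0 := by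
  have h := angle_bounds ha hab
  exact ⟨(Real.sin_pos_of_pos_of_lt_pi h.1 (by linarith [Real.pi_pos, h.2])).ne',
    (Real.cos_pos_of_mem_Ioo ⟨by linarith [h.1], h.2⟩).ne'⟩

/-- The roots of `A`. -/
def rootA (j : Fin (L + 1)) : ℝ :=
  (1 - Real.cos (2 * (((j : ℝ) + 1) * Real.pi / (2 * L + 3)))) / (2 ^ d - 1)

/-- The roots of `cofactor`. -/
def rootCofactor (j : Fin (L + 1)) : ℝ :=
  (1 - Real.cos (2 * ((2 * (j : ℝ) + 1) * Real.pi / (4 * L + 6)))) / (2 ^ d - 1)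

theorem fin_cast_le (j : Fin (L + 1)) : (j : ℝ) ≤ L := by
  exact_mod_cast Nat.lt_succ_iff.mp j.2

theorem rootA_strictMono (hd : 2 ≤ d) : StrictMono (rootA L d) := by
  intro j k hjk
  have h1 := fin_cast_le L k
  have h2 : (j : ℝ) < k := by exact_mod_cast hjk
  have := Real.pi_pos
  refine point_lt_point d hd (by positivity) ?_
    (angle_bounds (by positivity) (by linarith)).2
  gcongr

theorem rootCofactor_strictMono (hd : 2 ≤ d) : StrictMono (rootCofactor L d) := by
  intro j k hjk
  have h1 := fin_cast_le L k
  have h2 : (j : ℝ) < k := by exact_mod_cast hjk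
  have := Real.pi_pos
  refine point_lt_point d hd (by positivity) ?_
    (angle_bounds (by positivity) (by linarith)).2
  gcongr

theorem eval_A_rootA (hd : 2 ≤ d) (j : Fin (L + 1)) : (A (L + 2) d).eval (rootA L d j) = 0 := by
  have h1 := fin_cast_le L j
  have h2 := sin_ne_zero_and_cos_ne_zero (a := (j : ℝ) + 1) (b := 2 * L + 3) (by positivity) (by linarith)
  have h3 := cU_add_mul_sin L h2.2
  rw [eval_A, rootA, tVal_div d hd]
  have h4 : (2 * (L : ℝ) + 3) * (((j : ℝ) + 1) * Real.pi / (2 * L + 3)) =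
    ((j + 1 : ℕ) : ℝ) * Real.pi := by
    push_cast; field_simp
  rw [h4, Real.sin_nat_mul_pi] at h3
  exact (mul_eq_zero.mp h3).resolve_right h2.1

theorem eval_cofactor_rootCofactor (hd : 2 ≤ d) (j : Fin (L + 1)) :
    (cofactor L d).eval (rootCofactor L d j) = 0 := by
  have h1 := fin_cast_le L j
  have h2 := sin_ne_zero_and_cos_ne_zero (a := 2 * (j : ℝ) + 1) (b := 4 * L + 6) (by positivity)
    (by linarith)
  have h3 := cU_sub_mul_cos L h2.1
  rw [eval_cofactor, rootCofactor, tVal_div d hd]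
  have h4 : (2 * (L : ℝ) + 3) * ((2 * (j : ℝ) + 1) * Real.pi / (4 * L + 6)) =
    Real.pi / 2 + (j : ℕ) * Real.pi := by
    field_simp; ring
  rw [h4, Real.cos_add_nat_mul_pi, Real.cos_pi_div_two, mul_zero] at h3
  exact (mul_eq_zero.mp h3).resolve_right h2.2

theorem A_ne_zero (hd : 2 ≤ d) : A (L + 2) d ≠ 0 := by
  intro h
  have h1 := eval_R_of_A L d hd (y := top d) (by rw [h, eval_zero])
  linarith [top_lt_eval_R_top L d hd, top_pos d hd]

theorem cofactor_ne_zero (hd : 2 ≤ d) : cofactor L d ≠ 0 := by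
  intro h
  have h1 := eval_R_of_cofactor L d hd (y := top d) (by rw [h, eval_zero])
  linarith [top_lt_eval_R_top L d hd]

theorem S_ne_zero (hd : 2 ≤ d) : S (L + 2) d ≠ 0 := by
  intro h
  have h1 := eval_R_of_S L d hd (y := top d) (by rw [h, eval_zero])
  linarith [top_lt_eval_R_top L d hd]

theorem ncard_roots_A (hd : 2 ≤ d) : {y : ℝ | (A (L + 2) d).eval y = 0}.ncard = L + 1 :=
  ncard_roots (A_ne_zero L d hd) (natDegree_A_le L d) (rootA_strictMono L d hd).injective
    (eval_A_rootA L d hd)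

theorem cofactor_root_iff (hd : 2 ≤ d) (y : ℝ) :
    (cofactor L d).eval y = 0 ↔ ∃ j, rootCofactor L d j = y :=
  root_iff (cofactor_ne_zero L d hd) (natDegree_cofactor_le L d)
    (rootCofactor_strictMono L d hd).injective (eval_cofactor_rootCofactor L d hd) y

theorem ncard_roots_cofactor (hd : 2 ≤ d) :
    {y : ℝ | (cofactor L d).eval y = 0}.ncard = L + 1 :=
  ncard_roots (cofactor_ne_zero L d hd) (natDegree_cofactor_le L d)
    (rootCofactor_strictMono L d hd).injective (eval_cofactor_rootCofactor L d hd)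

theorem top_mem (hd : 2 ≤ d) : top d ∈ Set.Icc 0 (top d) := ⟨(top_pos d hd).le, le_rfl⟩

/-- The angle `(2j+1)π/(4L+6)` of the root lies between the node angles `2jπ/(4L+5)` and
`(2j+1)π/(4L+5)`. -/
theorem branch_top_even (hd : 2 ≤ d) (j : Fin (L + 1)) :
    branch (L + 2) d (2 * j) (top d) = rootCofactor L d j := by
  have h1 := fin_cast_le L j
  have h0 := j.2
  have hpi := Real.pi_pos
  have hP := four_le_two_pow d hd
  refine branch_eq_of_mem_Ico L d hd (top_mem d hd)
    (eval_R_of_cofactor L d hd (eval_cofactor_rootCofactor L d hd j)) (by omega) ⟨?_, ?_⟩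
  · rw [node, if_pos (by omega), rootCofactor]
    push_cast
    refine (point_lt_point d hd (by positivity) ?_
      (angle_bounds (by positivity) (by linarith)).2).le
    rw [div_lt_div_iff₀ (by positivity) (by positivity)]
    have : 2 * (j : ℝ) * (4 * L + 6) < (2 * j + 1) * (4 * L + 5) := by linarith
    nlinarith
  · rw [node, if_pos (by omega), rootCofactor]
    push_cast
    refine point_lt_point d hd (by positivity) ?_
      (angle_bounds (by positivity) (by linarith)).2
    gcongr
    linarith

/-- Explains admissibility: the remaining `n` branches at `top`, including the even index `2n - 2`,
are zeros of `S`, where extension breaks down. -/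
theorem cofactor_branch_top_iff (hd : 2 ≤ d) {l : ℕ} (hl : l < 2 * L + 3) :
    (cofactor L d).eval (branch (L + 2) d l (top d)) = 0 ↔ Even l ∧ l + 4 ≤ 2 * (L + 2) := by
  rw [cofactor_root_iff L d hd]
  constructor
  · rintro ⟨j, hj⟩
    rw [← branch_top_even L d hd] at hj
    have h0 := j.2
    have := branch_injective L d hd (top_mem d hd) (by omega) hl hj
    exact ⟨⟨j, by omega⟩, by omega⟩
  · rintro ⟨⟨k, rfl⟩, h⟩
    refine ⟨⟨k, by omega⟩, ?_⟩
    rw [← branch_top_even L d hd]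
    congr 1
    simp only
    omega

/-! ### Simple real roots of `S` -/

/-- Points at which `S` has alternating signs. -/
def nodeS (k : ℕ) : ℝ :=
  if k ≤ L + 1 then (1 - Real.cos (2 * (k * Real.pi / (2 * L + 3)))) / (2 ^ d - 1) else top d

theorem nodeS_lt_succ (hd : 2 ≤ d) {k : ℕ} (hk : k < L + 2) : nodeS L d k < nodeS L d (k + 1) := by
  rw [nodeS, nodeS, if_pos (by omega)]
  split_ifs with h
  · have h1 : ((k + 1 : ℕ) : ℝ) ≤ L + 1 := by exact_mod_cast h
    have h2 := (angle_bounds (a := ((k + 1 : ℕ) : ℝ)) (b := 2 * L + 3) (by positivity)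
      (by linarith)).2
    refine point_lt_point d hd (by positivity) ?_ h2
    have := Real.pi_pos
    push_cast
    gcongr
    linarith
  · exact point_lt_top d hd _

theorem nodeS_mono (hd : 2 ≤ d) {j k : ℕ} (hjk : j ≤ k) (hk : k ≤ L + 2) :
    nodeS L d j ≤ nodeS L d k := by
  induction k, hjk using Nat.le_induction with
  | base => exact le_rfl
  | succ k hjk ih => exact (ih (by omega)).trans (nodeS_lt_succ L d hd (by omega)).le

/-- At `h = kπ/(2L+3)` the sine term of `eval_S_trig` drops out, leaving `(-1)^k 2^d cos h`. The
last sign change comes from `top`, beyond the trigonometric range. -/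
theorem eval_S_nodeS (hd : 2 ≤ d) {k : ℕ} (hk : k ≤ L + 2) :
    0 < (-1) ^ k * (S (L + 2) d).eval (nodeS L d k) := by
  rcases eq_or_lt_of_le hk with h | h
  · rw [h, nodeS, if_neg (by omega)]
    have := eval_S_top_sign L d hd
    rw [pow_add]
    simpa using this
  · have h1 : (k : ℝ) ≤ L + 1 := by exact_mod_cast Nat.lt_succ_iff.mp h
    have hP := four_le_two_pow d hd
    have hpi := Real.pi_pos
    have hcos : 0 < Real.cos (k * Real.pi / (2 * L + 3)) := by
      refine Real.cos_pos_of_mem_Ioo ⟨lt_of_lt_of_le (by linarith : -(Real.pi / 2) < 0)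
        (by positivity), ?_⟩
      rw [div_lt_div_iff₀ (by positivity) two_pos]
      nlinarith
    have hx : tVal d (nodeS L d k) = Real.cos (2 * (k * Real.pi / (2 * L + 3))) := by
      rw [nodeS, if_pos (by omega), tVal_div d hd]
    rw [eval_S_trig L d hx]
    have h4 : (2 * (L : ℝ) + 3) * ((k : ℝ) * Real.pi / (2 * L + 3)) = k * Real.pi := by
      field_simp
    rw [h4, Real.sin_nat_mul_pi, Real.cos_nat_mul_pi]
    have h5 : (-1 : ℝ) ^ k * (-1) ^ k = 1 := by rw [← mul_pow]; norm_num
    have : (-1) ^ k * (2 ^ d * (-1) ^ k * Real.cos (k * Real.pi / (2 * L + 3)) +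
      (2 ^ d - 2) * 0 * Real.sin (k * Real.pi / (2 * L + 3))) =
        (-1) ^ k * (-1) ^ k * (2 ^ d * Real.cos (k * Real.pi / (2 * L + 3))) := by ring
    rw [this, h5, one_mul]
    positivity

theorem exists_root_S (hd : 2 ≤ d) {k : ℕ} (hk : k < L + 2) :
    ∃ y ∈ Set.Ico (nodeS L d k) (nodeS L d (k + 1)), (S (L + 2) d).eval y = 0 := by
  have h1 := eval_S_nodeS L d hd hk.le
  have h2 := eval_S_nodeS L d hd (Nat.succ_le_of_lt hk)
  have hle := (nodeS_lt_succ L d hd hk).le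
  have hcont : ContinuousOn (fun y => (-1) ^ k * (S (L + 2) d).eval y)
      (Set.Icc (nodeS L d k) (nodeS L d (k + 1))) :=
    (continuous_const.mul (Polynomial.continuous _)).continuousOn
  rw [Nat.succ_eq_add_one, pow_succ] at h2
  obtain ⟨y, hy, hy0⟩ := intermediate_value_Ioo' hle hcont (show (0 : ℝ) ∈ _ from
    ⟨by linarith, h1⟩)
  refine ⟨y, ⟨hy.1.le, hy.2⟩, ?_⟩
  exact (mul_eq_zero.mp hy0).resolve_left (pow_ne_zero _ (by norm_num))

theorem ncard_roots_S (hd : 2 ≤ d) : {y : ℝ | (S (L + 2) d).eval y = 0}.ncard = L + 2 := by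
  choose r hr hr0 using fun k : Fin (L + 2) => exists_root_S L d hd k.2
  exact ncard_roots (S_ne_zero L d hd) (natDegree_S_le L d)
    (strictMono_of_mem_Ico (fun j k hjk hk => nodeS_mono L d hd hjk hk) hr).injective hr0

/-! ### Expected multiplicities and the dimension count -/

theorem card_level_C [NeZero d] (m : ℕ) :
    Fintype.card (level L d m).C = (2 ^ d * (L + 1) + 1) ^ m := by
  induction m with
  | zero => rfl
  | succ m ih =>
    have := card_refine_C L opp opp_ne (level L d m)
    rw [ih] at this
    refine this.trans ?_
    rw [pow_succ]
    simp

theorem card_level_V [NeZero d] (m : ℕ) :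
    Fintype.card (level L d m).V = (2 ^ d - 1) * (2 ^ d * (L + 1) + 1) ^ m + 1 := by
  induction m with
  | zero =>
    have h : 1 ≤ 2 ^ d := Nat.one_le_two_pow
    change Fintype.card (Fin d → Bool) = _
    simp
    omega
  | succ m ih =>
    have := card_refine_V L opp opp_ne (level L d m)
    rw [ih, card_level_C] at this
    refine this.trans ?_
    simp only [Fintype.card_fun, Fintype.card_bool, Fintype.card_fin]
    ring

open Classical in
/-- The multiplicity of `x` as a Dirichlet eigenvalue at level `m`, given by recursion through the
decimation polynomial. -/
def expectedMult : ℕ → ℝ → ℕ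
  | 0, _ => 0
  | m + 1, x =>
    if x = top d then (2 ^ d * (L + 1) + 1) ^ (m + 1) * (2 ^ d - 2) + 1 - 2 ^ d
    else if (A (L + 2) d).eval x = 0 then 2 ^ d - 1
    else if (S (L + 2) d).eval x = 0 then (if m = 0 then 1 else 0)
    else expectedMult m ((R (L + 2) d).eval x)

theorem expectedMult_top (m : ℕ) : expectedMult L d (m + 1) (top d) =
    (2 ^ d * (L + 1) + 1) ^ (m + 1) * (2 ^ d - 2) + 1 - 2 ^ d := by
  rw [expectedMult, if_pos rfl]

theorem expectedMult_step (m : ℕ) {x : ℝ} (h1 : x ≠ top d) (h2 : (A (L + 2) d).eval x ≠ 0)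
    (h3 : (S (L + 2) d).eval x ≠ 0) :
    expectedMult L d (m + 1) x = expectedMult L d m ((R (L + 2) d).eval x) := by
  rw [expectedMult, if_neg h1, if_neg h2, if_neg h3]

theorem ne_top_of_eval_R (hd : 2 ≤ d) {y : ℝ} (h : (R (L + 2) d).eval y ≤ top d) : y ≠ top d := by
  rintro rfl
  linarith [top_lt_eval_R_top L d hd]

theorem expectedMult_of_A (hd : 2 ≤ d) (m : ℕ) {x : ℝ} (h : (A (L + 2) d).eval x = 0) :
    expectedMult L d (m + 1) x = 2 ^ d - 1 := by
  have h1 := eval_R_of_A L d hd h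
  rw [expectedMult, if_neg (ne_top_of_eval_R L d hd (by rw [h1]; exact (top_pos d hd).le)),
    if_pos h]

theorem eval_A_ne_zero (hd : 2 ≤ d) {x : ℝ} (h : (R (L + 2) d).eval x ≠ 0) :
    (A (L + 2) d).eval x ≠ 0 := fun hA => h (eval_R_of_A L d hd hA)

theorem expectedMult_of_S (hd : 2 ≤ d) (m : ℕ) {x : ℝ} (h : (S (L + 2) d).eval x = 0) :
    expectedMult L d (m + 1) x = if m = 0 then 1 else 0 := by
  have h1 := eval_R_of_S L d hd h
  rw [expectedMult, if_neg (ne_top_of_eval_R L d hd h1.le),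
    if_neg (eval_A_ne_zero L d hd (by rw [h1]; exact (top_pos d hd).ne')), if_pos h]

theorem expectedMult_of_cofactor (hd : 2 ≤ d) (m : ℕ) {x : ℝ}
    (h : (cofactor L d).eval x = 0) :
    expectedMult L d (m + 1) x = expectedMult L d m (top d) := by
  have h1 := eval_R_of_cofactor L d hd h
  rw [expectedMult_step L d m (ne_top_of_eval_R L d hd h1.le)
    (eval_A_ne_zero L d hd (by rw [h1]; exact (top_pos d hd).ne'))
    (eval_S_ne_zero_of_cofactor L d hd h), h1]

theorem expectedMult_of_eval_R (hd : 2 ≤ d) (m : ℕ) {x y : ℝ} (hx : x ∈ Set.Ioo 0 (top d))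
    (h : (R (L + 2) d).eval y = x) : expectedMult L d (m + 1) y = expectedMult L d m x := by
  rw [expectedMult_step L d m (ne_top_of_eval_R L d hd (by rw [h]; exact hx.2.le))
    (eval_A_ne_zero L d hd (by rw [h]; exact hx.1.ne')), h]
  intro hS
  rw [eval_R_of_S L d hd hS] at h
  exact hx.2.ne h.symm

theorem four_le_two_pow_nat (hd : 2 ≤ d) : 4 ≤ 2 ^ d :=
  (Nat.pow_le_pow_right (by norm_num) hd : 2 ^ 2 ≤ 2 ^ d)

/-- Each clause of the recursion is realised by one construction: zero cell sums, resonance at zeros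
of `A`, the symmetric function on a single subdivided cell, and extension along `R`. -/
theorem expectedMult_le [NeZero d] (hd : 2 ≤ d) (m : ℕ) (x : ℝ) :
    expectedMult L d m x ≤ dirichletMultiplicity (L + 2) d m x := by
  induction m generalizing x with
  | zero => exact Nat.zero_le _
  | succ m ih =>
    have hP := four_le_two_pow_nat d hd
    have hcard : Fintype.card (Fin d → Bool) = 2 ^ d := by simp
    have hcard' : (Fintype.card (Fin d → Bool) : ℝ) = 2 ^ d := by simp
    have h3 : 3 ≤ Fintype.card (Fin d → Bool) := by rw [hcard]; omega
    have hs : (2 ^ d - (2 ^ d - 1) * x : ℝ) = tVal d x + Fintype.card (Fin d → Bool) - 1 := by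
      rw [hcard', tVal]; ring
    rw [dirichletMultiplicity, finrank_dirichletEigenspace]
    by_cases htop : x = top d
    · rw [htop, expectedMult_top, top_mul d hd, sub_self]
      have h1 := card_le_finrank_eigen_zero (level L d (m + 1))
      rw [card_level_V, card_level_C, hcard] at h1
      generalize finrank ℝ ((level L d (m + 1)).eigen 0) = e at *
      generalize (2 ^ d * (L + 1) + 1) ^ (m + 1) = Z at *
      obtain ⟨p, hp⟩ : ∃ p, 2 ^ d = p + 2 := ⟨2 ^ d - 2, by omega⟩
      rw [hp] at h1 ⊢
      rw [show p + 2 - 1 = p + 1 by omega] at h1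
      rw [show p + 2 - 2 = p by omega]
      have : (p + 1) * Z = Z * p + Z := by ring
      omega
    · by_cases hA : (A (L + 2) d).eval x = 0
      · rw [expectedMult_of_A L d hd m hA]
        rw [eval_A] at hA
        have h1 := le_finrank_refine_of_resonance L opp opp_ne h3 (level L d m)
          (bdry_injective L d m) (tVal d x) _ hs hA
        rw [card_level_V, card_level_C, hcard] at h1
        change _ ≤ finrank ℝ ((level L d (m + 1)).eigen _) + _ + _ at h1
        generalize finrank ℝ ((level L d (m + 1)).eigen (2 ^ d - (2 ^ d - 1) * x)) = e at *
        generalize (2 ^ d * (L + 1) + 1) ^ m = Z at *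
        obtain ⟨p, hp⟩ : ∃ p, 2 ^ d = p + 1 := ⟨2 ^ d - 1, by omega⟩
        rw [hp] at h1 ⊢
        rw [show p + 1 - 1 = p by omega] at h1 ⊢
        have : (p + 1) * Z = p * Z + Z := by ring
        omega
      · by_cases hS : (S (L + 2) d).eval x = 0
        · rw [expectedMult_of_S L d hd m hS]
          split_ifs with hm
          · subst hm
            rw [eval_S, ← hcard'] at hS
            exact one_le_finrank_refine_base L opp opp_ne h3 (tVal d x) _ hs hS
          · exact Nat.zero_le _
        · rw [expectedMult_step L d m htop hA hS]
          refine (ih _).trans ?_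
          rw [dirichletMultiplicity, finrank_dirichletEigenspace]
          have h1 := eval_R_rel L d x
          rw [eval_S, eval_cofactor] at h1
          rw [eval_A] at hA
          rw [eval_S] at hS
          exact finrank_eigen_le_refine L opp opp_ne (level L d m) (tVal d x) _ _ hs hA
            (by rw [hcard']; exact hS) (by rw [h1, hcard'])

theorem mem_Ioo_of_eval_R (hd : 2 ≤ d) {x y : ℝ} (hx : x ∈ Set.Ioc 0 (top d))
    (h : (R (L + 2) d).eval y = x) : y ∈ Set.Ioo 0 (top d) := by
  have h1 := mem_Ico_of_eval_R L d hd ⟨hx.1.le, hx.2⟩ h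
  refine ⟨lt_of_le_of_ne h1.1 ?_, h1.2⟩
  rintro rfl
  rw [eval_R_zero L d hd] at h
  exact hx.1.ne h

theorem mem_Ioo_of_A (hd : 2 ≤ d) {y : ℝ} (h : (A (L + 2) d).eval y = 0) :
    y ∈ Set.Ioo 0 (top d) := by
  have h1 := mem_Ico_of_eval_R L d hd ⟨le_rfl, (top_pos d hd).le⟩ (eval_R_of_A L d hd h)
  refine ⟨lt_of_le_of_ne h1.1 ?_, h1.2⟩
  rintro rfl
  rw [eval_A, show tVal d 0 = 1 by simp [tVal]] at h
  simp only [cU, Chebyshev.U_eval_one] at h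
  push_cast at h
  have : (0 : ℝ) ≤ L := L.cast_nonneg
  linarith

theorem mem_Ioo_of_S (hd : 2 ≤ d) {y : ℝ} (h : (S (L + 2) d).eval y = 0) :
    y ∈ Set.Ioo 0 (top d) :=
  mem_Ioo_of_eval_R L d hd ⟨top_pos d hd, le_rfl⟩ (eval_R_of_S L d hd h)

theorem mem_roots_toFinset {p : ℝ[X]} (hp : p ≠ 0) (y : ℝ) :
    y ∈ p.roots.toFinset ↔ p.eval y = 0 := by
  rw [Multiset.mem_toFinset, mem_roots hp]; rfl

theorem card_roots_toFinset {p : ℝ[X]} (hp : p ≠ 0) {N : ℕ}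
    (h : {y : ℝ | p.eval y = 0}.ncard = N) : p.roots.toFinset.card = N := by
  rw [← h, ← Set.ncard_coe_finset]
  congr 1
  ext y
  exact mem_roots_toFinset hp y

theorem sum_expectedMult_one (hd : 2 ≤ d) : ∃ F : Finset ℝ, top d ∈ F ∧
    (∀ x ∈ F, x ∈ Set.Ioc 0 (top d)) ∧
    ∑ x ∈ F, expectedMult L d 1 x + 2 ^ d = (2 ^ d - 1) * (2 ^ d * (L + 1) + 1) + 1 := by
  classical
  have hA := A_ne_zero L d hd
  have hS := S_ne_zero L d hd
  have hP := four_le_two_pow_nat d hd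
  have hdisj : Disjoint (A (L + 2) d).roots.toFinset (S (L + 2) d).roots.toFinset := by
    rw [Finset.disjoint_left]
    intro y h1 h2
    rw [mem_roots_toFinset hA] at h1
    rw [mem_roots_toFinset hS] at h2
    have h3 := eval_R_of_A L d hd h1
    rw [eval_R_of_S L d hd h2] at h3
    exact (top_pos d hd).ne' h3
  have htop : top d ∉ (A (L + 2) d).roots.toFinset ∪ (S (L + 2) d).roots.toFinset := by
    rw [Finset.mem_union, mem_roots_toFinset hA, mem_roots_toFinset hS]
    rintro (h | h)
    · exact (mem_Ioo_of_A L d hd h).2.ne rfl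
    · exact (mem_Ioo_of_S L d hd h).2.ne rfl
  refine ⟨insert (top d) ((A (L + 2) d).roots.toFinset ∪ (S (L + 2) d).roots.toFinset),
    Finset.mem_insert_self _ _, ?_, ?_⟩
  · intro x hx
    rw [Finset.mem_insert, Finset.mem_union, mem_roots_toFinset hA, mem_roots_toFinset hS] at hx
    rcases hx with rfl | h | h
    · exact ⟨top_pos d hd, le_rfl⟩
    · exact Set.Ioo_subset_Ioc_self (mem_Ioo_of_A L d hd h)
    · exact Set.Ioo_subset_Ioc_self (mem_Ioo_of_S L d hd h)
  · rw [Finset.sum_insert htop, Finset.sum_union hdisj, expectedMult_top,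
      Finset.sum_congr rfl fun x hx =>
        expectedMult_of_A L d hd 0 ((mem_roots_toFinset hA x).mp hx),
      Finset.sum_congr rfl fun x hx =>
        expectedMult_of_S L d hd 0 ((mem_roots_toFinset hS x).mp hx),
      Finset.sum_const, Finset.sum_const, card_roots_toFinset hA (ncard_roots_A L d hd),
      card_roots_toFinset hS (ncard_roots_S L d hd)]
    simp only [smul_eq_mul, if_true, mul_one, zero_add, pow_one]
    obtain ⟨p, hp⟩ : ∃ p, 2 ^ d = p + 2 := ⟨2 ^ d - 2, by omega⟩
    rw [hp, show p + 2 - 1 = p + 1 by omega, show p + 2 - 2 = p by omega]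
    have h0 : p + 2 ≤ (p + 2) * (L + 1) + 1 := by nlinarith
    have h1 : p + 2 ≤ ((p + 2) * (L + 1) + 1) * p + 1 :=
      (h0.trans (Nat.le_mul_of_pos_right _ (by omega))).trans (Nat.le_succ _)
    zify [h1]
    ring

/-- The new set consists of `top`, the zeros of `A`, the zeros of `cofactor` (which inherit the
previous multiplicity of `top`) and the full fibres over the other points of `F`. Zeros of `S` have
expected multiplicity 0 from level two on and are left out. -/
theorem sum_expectedMult_succ (hd : 2 ≤ d) (m : ℕ) {F : Finset ℝ} (hF : top d ∈ F)
    (hF' : ∀ x ∈ F, x ∈ Set.Ioc 0 (top d))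
    (hsum : ∑ x ∈ F, expectedMult L d (m + 1) x + 2 ^ d =
      (2 ^ d - 1) * (2 ^ d * (L + 1) + 1) ^ (m + 1) + 1) :
    ∃ F' : Finset ℝ, top d ∈ F' ∧ (∀ x ∈ F', x ∈ Set.Ioc 0 (top d)) ∧
    ∑ x ∈ F', expectedMult L d (m + 2) x + 2 ^ d =
      (2 ^ d - 1) * (2 ^ d * (L + 1) + 1) ^ (m + 2) + 1 := by
  classical
  have hA := A_ne_zero L d hd
  have hB := cofactor_ne_zero L d hd
  have hR := R_sub_ne_zero L d hd
  have hP := four_le_two_pow_nat d hd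
  have hpos := top_pos d hd
  let fib : ℝ → Finset ℝ := fun x => (R (L + 2) d - C x).roots.toFinset
  have hfib : ∀ x y, y ∈ fib x ↔ (R (L + 2) d).eval y = x := fun x y => by
    rw [mem_roots_toFinset (hR x), eval_sub, eval_C, sub_eq_zero]
  have hx : ∀ x ∈ F.erase (top d), x ∈ Set.Ioo 0 (top d) := fun x h => by
    rw [Finset.mem_erase] at h
    exact ⟨(hF' x h.2).1, lt_of_le_of_ne (hF' x h.2).2 h.1⟩
  have hfibcard : ∀ x ∈ F.erase (top d), (fib x).card = 2 * L + 3 := fun x h => by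
    refine card_roots_toFinset (hR x) ?_
    rw [← ncard_preimage L d hd (Set.Ioo_subset_Icc_self (hx x h))]
    simp only [eval_sub, eval_C, sub_eq_zero]
  have hdisj1 : Disjoint (A (L + 2) d).roots.toFinset (cofactor L d).roots.toFinset := by
    rw [Finset.disjoint_left]
    intro y h1 h2
    rw [mem_roots_toFinset hA] at h1
    rw [mem_roots_toFinset hB] at h2
    have h3 := eval_R_of_A L d hd h1
    rw [eval_R_of_cofactor L d hd h2] at h3
    exact hpos.ne' h3
  have hdisj2 : Disjoint ((A (L + 2) d).roots.toFinset ∪ (cofactor L d).roots.toFinset)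
      ((F.erase (top d)).biUnion fib) := by
    rw [Finset.disjoint_left]
    intro y h1 h2
    rw [Finset.mem_union, mem_roots_toFinset hA, mem_roots_toFinset hB] at h1
    obtain ⟨x, hxF, hy⟩ := Finset.mem_biUnion.mp h2
    rw [hfib] at hy
    rcases h1 with h | h
    · rw [eval_R_of_A L d hd h] at hy
      exact (hx x hxF).1.ne hy
    · rw [eval_R_of_cofactor L d hd h] at hy
      exact (hx x hxF).2.ne' hy
  have hmem : ∀ y ∈ ((A (L + 2) d).roots.toFinset ∪ (cofactor L d).roots.toFinset) ∪
      ((F.erase (top d)).biUnion fib), y ∈ Set.Ioo 0 (top d) := by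
    intro y hy
    rw [Finset.mem_union, Finset.mem_union, mem_roots_toFinset hA, mem_roots_toFinset hB,
      Finset.mem_biUnion] at hy
    rcases hy with (h | h) | ⟨x, hxF, hy⟩
    · exact mem_Ioo_of_A L d hd h
    · exact mem_Ioo_of_eval_R L d hd ⟨hpos, le_rfl⟩ (eval_R_of_cofactor L d hd h)
    · rw [hfib] at hy
      exact mem_Ioo_of_eval_R L d hd (Set.Ioo_subset_Ioc_self (hx x hxF)) hy
  have hpair : (↑(F.erase (top d)) : Set ℝ).PairwiseDisjoint fib := by
    intro x _ x' _ hne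
    rw [Function.onFun, Finset.disjoint_left]
    intro y h1 h2
    rw [hfib] at h1 h2
    exact hne (h1.symm.trans h2)
  refine ⟨insert (top d) (((A (L + 2) d).roots.toFinset ∪ (cofactor L d).roots.toFinset) ∪
      ((F.erase (top d)).biUnion fib)), Finset.mem_insert_self _ _, ?_, ?_⟩
  · intro x hx
    rcases Finset.mem_insert.mp hx with rfl | h
    · exact ⟨hpos, le_rfl⟩
    · exact Set.Ioo_subset_Ioc_self (hmem x h)
  · rw [Finset.sum_insert fun h => (hmem _ h).2.ne rfl, Finset.sum_union hdisj2,
      Finset.sum_union hdisj1, Finset.sum_biUnion hpair, expectedMult_top,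
      Finset.sum_congr rfl fun x hx =>
        expectedMult_of_A L d hd (m + 1) ((mem_roots_toFinset hA x).mp hx),
      Finset.sum_congr rfl fun x hx =>
        expectedMult_of_cofactor L d hd (m + 1) ((mem_roots_toFinset hB x).mp hx),
      Finset.sum_const, Finset.sum_const, card_roots_toFinset hA (ncard_roots_A L d hd),
      card_roots_toFinset hB (ncard_roots_cofactor L d hd)]
    have hinner : ∀ x ∈ F.erase (top d), ∑ y ∈ fib x, expectedMult L d (m + 2) y =
        (2 * L + 3) * expectedMult L d (m + 1) x := fun x h => by
      rw [Finset.sum_congr rfl fun y hy =>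
        expectedMult_of_eval_R L d hd (m + 1) (hx x h) ((hfib x y).mp hy),
        Finset.sum_const, hfibcard x h, smul_eq_mul]
    rw [Finset.sum_congr rfl hinner, ← Finset.mul_sum]
    rw [← Finset.add_sum_erase _ _ hF] at hsum
    generalize ∑ x ∈ F.erase (top d), expectedMult L d (m + 1) x = T at *
    rw [expectedMult_top] at *
    simp only [smul_eq_mul]
    rw [pow_succ _ (m + 1)]
    have hZ : 1 ≤ (2 ^ d * (L + 1) + 1) ^ (m + 1) := Nat.one_le_pow _ _ (by omega)
    have hZ' : 2 ^ d * (L + 1) + 1 ≤ (2 ^ d * (L + 1) + 1) ^ (m + 1) :=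
      Nat.le_self_pow (by omega) _
    generalize (2 ^ d * (L + 1) + 1) ^ (m + 1) = Z at *
    obtain ⟨p, hp⟩ : ∃ p, 2 ^ d = p + 2 := ⟨2 ^ d - 2, by omega⟩
    rw [hp] at hsum hZ' ⊢
    rw [show p + 2 - 1 = p + 1 by omega, show p + 2 - 2 = p by omega] at hsum ⊢
    -- These bounds show that the natural-number subtractions do not truncate, so the identity can
    -- be checked in `ℤ`.
    have h0 : p + 2 ≤ Z := by nlinarith
    have h1 : p + 2 ≤ Z * p + 1 :=
      (h0.trans (Nat.le_mul_of_pos_right _ (by omega))).trans (Nat.le_succ _)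
    have h2 : p + 2 ≤ Z * ((p + 2) * (L + 1) + 1) * p + 1 :=
      ((h0.trans (Nat.le_mul_of_pos_right _ (by omega))).trans
        (Nat.le_mul_of_pos_right _ (by omega))).trans (Nat.le_succ _)
    zify [h1] at hsum
    zify [h1, h2]
    linear_combination (2 * (L : ℤ) + 3) * hsum

theorem exists_sum_expectedMult (hd : 2 ≤ d) (m : ℕ) : ∃ F : Finset ℝ, top d ∈ F ∧
    (∀ x ∈ F, x ∈ Set.Ioc 0 (top d)) ∧
    ∑ x ∈ F, expectedMult L d (m + 1) x + 2 ^ d =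
      (2 ^ d - 1) * (2 ^ d * (L + 1) + 1) ^ (m + 1) + 1 := by
  induction m with
  | zero =>
    have := sum_expectedMult_one L d hd
    simpa using this
  | succ m ih =>
    obtain ⟨F, h1, h2, h3⟩ := ih
    exact sum_expectedMult_succ L d hd m h1 h2 h3

/-- The lower bounds over `F` already use up the available dimension. Adding an arbitrary `x` to `F`
cannot exceed it, so all termwise inequalities are equalities, including the one at `x`. -/
theorem dirichletMultiplicity_eq (hd : 2 ≤ d) (m : ℕ) (x : ℝ) :
    dirichletMultiplicity (L + 2) d (m + 1) x = expectedMult L d (m + 1) x := by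
  classical
  have : NeZero d := ⟨by omega⟩
  obtain ⟨F, -, -, hF⟩ := exists_sum_expectedMult L d hd m
  have h1 := sum_multiplicity_le L d (m + 1) (insert x F)
  rw [card_level_V, ← hF] at h1
  have hle : ∀ y, expectedMult L d (m + 1) y ≤ dirichletMultiplicity (L + 2) d (m + 1) y :=
    expectedMult_le L d hd (m + 1)
  have h2 : ∑ y ∈ insert x F, dirichletMultiplicity (L + 2) d (m + 1) y ≤
      ∑ y ∈ insert x F, expectedMult L d (m + 1) y :=
    (by omega : _ ≤ ∑ y ∈ F, expectedMult L d (m + 1) y).trans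
      (Finset.sum_le_sum_of_subset (Finset.subset_insert x F))
  have h3 := (Finset.sum_eq_sum_iff_of_le fun y _ => hle y).mp
    (le_antisymm (Finset.sum_le_sum fun y _ => hle y) h2)
  exact (h3 x (Finset.mem_insert_self _ _)).symm

/-! ### Words of inverse branches -/

theorem branch_mem_Ioo (hd : 2 ≤ d) {x : ℝ} (hx : x ∈ Set.Ioc 0 (top d)) {l : ℕ}
    (hl : l < 2 * L + 3) : branch (L + 2) d l x ∈ Set.Ioo 0 (top d) :=
  mem_Ioo_of_eval_R L d hd hx (eval_R_branch L d hd ⟨hx.1.le, hx.2⟩ hl)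

/-- Every letter raises the level by one and keeps the multiplicity. At `top` itself this fails for
letters leading to a zero of `S`, hence the open interval. -/
theorem expectedMult_branchWord (hd : 2 ≤ d) (v : List (Fin (2 * (L + 2) - 1))) (k : ℕ) {x : ℝ}
    (hx : x ∈ Set.Ioo 0 (top d)) :
    expectedMult L d (k + v.length) (branchWord (L + 2) d v x) = expectedMult L d k x := by
  induction v generalizing k x with
  | nil => rfl
  | cons l v ih =>
    have hl : (l : ℕ) < 2 * L + 3 := by omega
    have hx' := Set.Ioo_subset_Ioc_self hx
    change expectedMult L d (k + (v.length + 1)) (branchWord (L + 2) d v (branch (L + 2) d l x)) = _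
    rw [show k + (v.length + 1) = (k + 1) + v.length by ring,
      ih (k + 1) (branch_mem_Ioo L d hd hx' hl)]
    exact expectedMult_of_eval_R L d hd k hx (eval_R_branch L d hd ⟨hx'.1.le, hx'.2⟩ hl)

theorem expectedMult_branchWord_top (hd : 2 ≤ d) (v : List (Fin (2 * (L + 2) - 1)))
    (hv : Admissible v) (k : ℕ) :
    expectedMult L d (k + v.length) (branchWord (L + 2) d v (top d)) =
      expectedMult L d k (top d) := by
  cases v with
  | nil => rfl
  | cons l v =>
    have hl : (l : ℕ) < 2 * L + 3 := by omega
    change expectedMult L d (k + (v.length + 1))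
      (branchWord (L + 2) d v (branch (L + 2) d l (top d))) = _
    rw [show k + (v.length + 1) = (k + 1) + v.length by ring, expectedMult_branchWord L d hd v _
      (branch_mem_Ioo L d hd ⟨top_pos d hd, le_rfl⟩ hl)]
    exact expectedMult_of_cofactor L d hd k
      ((cofactor_branch_top_iff L d hd hl).mpr (hv l (by simp)))

theorem branchWord_mem_Ioc (hd : 2 ≤ d) (v : List (Fin (2 * (L + 2) - 1))) {x : ℝ}
    (hx : x ∈ Set.Ioc 0 (top d)) : branchWord (L + 2) d v x ∈ Set.Ioc 0 (top d) := by
  induction v generalizing x with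
  | nil => exact hx
  | cons l v ih =>
    exact ih (Set.Ioo_subset_Ioc_self (branch_mem_Ioo L d hd hx (by omega)))

/-- Iterating `R` from `x` must stop at `top`, at a zero of `A`, or at a zero of `S` with one level
left. Each step undone appends a letter at the end of the word. -/
theorem exists_word_of_expectedMult_ne_zero (hd : 2 ≤ d) (m : ℕ) {x : ℝ}
    (h : expectedMult L d m x ≠ 0) :
    (∃ v : List (Fin (2 * (L + 2) - 1)), v.length + 1 ≤ m ∧ Admissible v ∧
      x = branchWord (L + 2) d v (top d)) ∨
    (∃ α : ℝ, (S (L + 2) d).eval α = 0 ∧ ∃ v : List (Fin (2 * (L + 2) - 1)), v.length + 1 = m ∧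
      x = branchWord (L + 2) d v α) ∨
    (∃ β : ℝ, (A (L + 2) d).eval β = 0 ∧ ∃ v : List (Fin (2 * (L + 2) - 1)), v.length + 1 ≤ m ∧
      x = branchWord (L + 2) d v β) := by
  induction m generalizing x with
  | zero => exact absurd rfl h
  | succ m ih =>
    by_cases htop : x = top d
    · exact Or.inl ⟨[], by simp, by simp [Admissible], htop⟩
    by_cases hA : (A (L + 2) d).eval x = 0
    · exact Or.inr (Or.inr ⟨x, hA, [], by simp, rfl⟩)
    by_cases hS : (S (L + 2) d).eval x = 0
    · rw [expectedMult_of_S L d hd m hS] at h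
      have hm : m = 0 := by
        by_contra hm
        exact h (if_neg hm)
      exact Or.inr (Or.inl ⟨x, hS, [], by simp [hm], rfl⟩)
    rw [expectedMult_step L d m htop hA hS] at h
    have happ : ∀ (v : List (Fin (2 * (L + 2) - 1))) (y : ℝ), y ∈ Set.Ioc 0 (top d) →
        (R (L + 2) d).eval x = branchWord (L + 2) d v y →
        ∃ l : Fin (2 * (L + 2) - 1), branch (L + 2) d l (branchWord (L + 2) d v y) = x ∧
          x = branchWord (L + 2) d (v ++ [l]) y := by
      intro v y hy hxy
      have h1 := branchWord_mem_Ioc L d hd v hy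
      obtain ⟨l, hl, hlx⟩ := exists_branch_eq L d hd ⟨h1.1.le, h1.2⟩ hxy
      refine ⟨⟨l, by omega⟩, hlx, ?_⟩
      rw [branchWord, List.foldl_append]
      exact hlx.symm
    rcases ih h with ⟨v, hv, hadm, he⟩ | ⟨α, hα, v, hv, he⟩ | ⟨β, hβ, v, hv, he⟩
    · obtain ⟨l, hl, hl'⟩ := happ v _ ⟨top_pos d hd, le_rfl⟩ he
      refine Or.inl ⟨v ++ [l], by simpa using hv, ?_, hl'⟩
      cases v with
      | nil =>
        intro l' hl'
        obtain rfl : l = l' := by simpa using hl'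
        change branch (L + 2) d l (top d) = x at hl
        -- Only the first letter is constrained: `x` lies over `top` and is no zero of `S`, hence is
        -- a zero of `cofactor`.
        have h2 := ((eval_R_eq_top_iff L d hd).mp he).resolve_left hS
        rw [← hl] at h2
        exact (cofactor_branch_top_iff L d hd (by omega)).mp h2
      | cons l₀ v =>
        intro l' hl'
        exact hadm l' (by simpa using hl')
    · obtain ⟨l, hl, hl'⟩ := happ v _ (Set.Ioo_subset_Ioc_self (mem_Ioo_of_S L d hd hα)) he
      exact Or.inr (Or.inl ⟨α, hα, v ++ [l], by simpa using hv, hl'⟩)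
    · obtain ⟨l, hl, hl'⟩ := happ v _ (Set.Ioo_subset_Ioc_self (mem_Ioo_of_A L d hd hβ)) he
      exact Or.inr (Or.inr ⟨β, hβ, v ++ [l], by simpa using hv, hl'⟩)

theorem mem_dirichletSpectrum_iff (hd : 2 ≤ d) (m : ℕ) (x : ℝ) :
    x ∈ dirichletSpectrum (L + 2) d (m + 1) ↔ expectedMult L d (m + 1) x ≠ 0 := by
  rw [← dirichletMultiplicity_eq L d hd]
  exact (not_congr Submodule.finrank_eq_zero).symm

theorem multiplicity_top_word (hd : 2 ≤ d) (m : ℕ) (v : List (Fin (2 * (L + 2) - 1)))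
    (hv : v.length ≤ m) (hadm : Admissible v) :
    expectedMult L d (m + 1) (branchWord (L + 2) d v (top d)) =
      (2 ^ d * (L + 1) + 1) ^ (m + 1 - v.length) * (2 ^ d - 2) + 1 - 2 ^ d := by
  have h1 := expectedMult_branchWord_top L d hd v hadm (m - v.length + 1)
  rw [show m - v.length + 1 + v.length = m + 1 by omega, expectedMult_top] at h1
  rw [h1, show m - v.length + 1 = m + 1 - v.length by omega]

/-- Makes the multiplicity at `top`-words positive and its truncated subtraction exact. -/
theorem two_pow_le_count (hd : 2 ≤ d) {j : ℕ} (hj : j ≠ 0) :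
    2 ^ d < (2 ^ d * (L + 1) + 1) ^ j * (2 ^ d - 2) + 1 := by
  have hP := four_le_two_pow_nat d hd
  have h1 : 2 ^ d * (L + 1) + 1 ≤ (2 ^ d * (L + 1) + 1) ^ j := Nat.le_self_pow hj _
  have h2 : 2 ≤ 2 ^ d - 2 := by omega
  have h3 := Nat.mul_le_mul h1 h2
  have h4 : 2 ^ d ≤ 2 ^ d * (L + 1) := Nat.le_mul_of_pos_right _ (by omega)
  omega

theorem multiplicity_S_word (hd : 2 ≤ d) (m : ℕ) {α : ℝ} (hα : (S (L + 2) d).eval α = 0)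
    (v : List (Fin (2 * (L + 2) - 1))) (hv : v.length = m) :
    expectedMult L d (m + 1) (branchWord (L + 2) d v α) = 1 := by
  have h1 := expectedMult_branchWord L d hd v 1 (mem_Ioo_of_S L d hd hα)
  rw [hv, add_comm] at h1
  rw [h1, expectedMult_of_S L d hd 0 hα, if_pos rfl]

theorem multiplicity_A_word (hd : 2 ≤ d) (m : ℕ) {β : ℝ} (hβ : (A (L + 2) d).eval β = 0)
    (v : List (Fin (2 * (L + 2) - 1))) (hv : v.length ≤ m) :
    expectedMult L d (m + 1) (branchWord (L + 2) d v β) = 2 ^ d - 1 := by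
  have h1 := expectedMult_branchWord L d hd v (m - v.length + 1) (mem_Ioo_of_A L d hd hβ)
  rw [show m - v.length + 1 + v.length = m + 1 by omega, expectedMult_of_A L d hd _ hβ] at h1
  exact h1

end Decimation

end
end Vicsek

/-! ### Assembly of the theorem -/

theorem theorem4p3 (n d m : ℕ) (hn : 2 ≤ n) (hd : 2 ≤ d) (hm : 1 ≤ m) :
    -- the inverse branches and the roots that label the families are well defined
    (∀ x ∈ Set.Icc (0 : ℝ) (Vicsek.top d),
      {y : ℝ | (Vicsek.R n d).eval y = x}.ncard = 2 * n - 1 ∧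
      {y : ℝ | (Vicsek.R n d).eval y = x} ⊆ Set.Icc 0 (Vicsek.top d)) ∧
    ({y : ℝ | (Vicsek.S n d).IsRoot y}.ncard = n ∧
      {y : ℝ | (Vicsek.S n d).IsRoot y} ⊆ Set.Icc 0 (Vicsek.top d)) ∧
    ({y : ℝ | (Vicsek.A n d).IsRoot y}.ncard = n - 1 ∧
      {y : ℝ | (Vicsek.A n d).IsRoot y} ⊆ Set.Icc 0 (Vicsek.top d)) ∧
    -- the spectrum
    Vicsek.dirichletSpectrum n d m =
      {lam | ∃ v : List (Fin (2 * n - 1)), v.length ≤ m - 1 ∧ Vicsek.Admissible v ∧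
        lam = Vicsek.branchWord n d v (Vicsek.top d)} ∪
      {lam | ∃ α : ℝ, (Vicsek.S n d).IsRoot α ∧ ∃ v : List (Fin (2 * n - 1)),
        v.length = m - 1 ∧ lam = Vicsek.branchWord n d v α} ∪
      {lam | ∃ β : ℝ, (Vicsek.A n d).IsRoot β ∧ ∃ v : List (Fin (2 * n - 1)),
        v.length ≤ m - 1 ∧ lam = Vicsek.branchWord n d v β} ∧
    -- the multiplicities
    (∀ v : List (Fin (2 * n - 1)), v.length ≤ m - 1 → Vicsek.Admissible v →
      (Vicsek.dirichletMultiplicity n d m (Vicsek.branchWord n d v (Vicsek.top d)) : ℤ) =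
        (2 ^ d * n - 2 ^ d + 1) ^ (m - v.length) * (2 ^ d - 2) + 1 - 2 ^ d) ∧
    (∀ α : ℝ, (Vicsek.S n d).IsRoot α → ∀ v : List (Fin (2 * n - 1)), v.length = m - 1 →
      Vicsek.dirichletMultiplicity n d m (Vicsek.branchWord n d v α) = 1) ∧
    (∀ β : ℝ, (Vicsek.A n d).IsRoot β → ∀ v : List (Fin (2 * n - 1)), v.length ≤ m - 1 →
      Vicsek.dirichletMultiplicity n d m (Vicsek.branchWord n d v β) = 2 ^ d - 1) := by
  obtain ⟨L, rfl⟩ : ∃ L, n = L + 2 := ⟨n - 2, by omega⟩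
  obtain ⟨m, rfl⟩ : ∃ k, m = k + 1 := ⟨m - 1, by omega⟩
  have hP := Vicsek.four_le_two_pow_nat d hd
  have hcount : ∀ v : List (Fin (2 * (L + 2) - 1)), v.length ≤ m →
      2 ^ d < (2 ^ d * (L + 1) + 1) ^ (m + 1 - v.length) * (2 ^ d - 2) + 1 :=
    fun v hv => Vicsek.two_pow_le_count L d hd (by omega)
  refine ⟨fun x hx => ⟨?_, fun y hy => ?_⟩, ⟨Vicsek.ncard_roots_S L d hd, fun y hy => ?_⟩,
    ⟨Vicsek.ncard_roots_A L d hd, fun y hy => ?_⟩, ?_, fun v hv hadm => ?_, fun α hα v hv => ?_,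
    fun β hβ v hv => ?_⟩
  · rw [Vicsek.ncard_preimage L d hd hx]
    omega
  · exact Set.Ico_subset_Icc_self (Vicsek.mem_Ico_of_eval_R L d hd hx hy)
  · exact Set.Ioo_subset_Icc_self (Vicsek.mem_Ioo_of_S L d hd hy)
  · exact Set.Ioo_subset_Icc_self (Vicsek.mem_Ioo_of_A L d hd hy)
  · ext x
    rw [Vicsek.mem_dirichletSpectrum_iff L d hd]
    constructor
    · intro h
      rcases Vicsek.exists_word_of_expectedMult_ne_zero L d hd (m + 1) h with
        ⟨v, hv, hadm, he⟩ | ⟨α, hα, v, hv, he⟩ | ⟨β, hβ, v, hv, he⟩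
      · exact Or.inl (Or.inl ⟨v, by omega, hadm, he⟩)
      · exact Or.inl (Or.inr ⟨α, hα, v, by omega, he⟩)
      · exact Or.inr ⟨β, hβ, v, by omega, he⟩
    · rintro ((⟨v, hv, hadm, rfl⟩ | ⟨α, hα, v, hv, rfl⟩) | ⟨β, hβ, v, hv, rfl⟩)
      · rw [Vicsek.multiplicity_top_word L d hd m v hv hadm]
        have := hcount v hv
        omega
      · rw [Vicsek.multiplicity_S_word L d hd m hα v hv]
        exact one_ne_zero
      · rw [Vicsek.multiplicity_A_word L d hd m hβ v hv]
        omega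
  · rw [Vicsek.dirichletMultiplicity_eq L d hd, Vicsek.multiplicity_top_word L d hd m v hv hadm,
      Nat.cast_sub (hcount v hv).le]
    push_cast [show 2 ≤ 2 ^ d by omega]
    ring
  · rw [Vicsek.dirichletMultiplicity_eq L d hd, Vicsek.multiplicity_S_word L d hd m hα v hv]
  · rw [Vicsek.dirichletMultiplicity_eq L d hd, Vicsek.multiplicity_A_word L d hd m hβ v hv]
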